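/- Let $(M,J)$ be a (finite-dimensional, Hausdorff) complex manifold with complex structure $J$, regarded also as a real $C^\infty$-manifold, and let $g$ be a $C^\infty$ pseudo-Riemannian metric on $M$ with Levi-Civita connection $\nabla$. Assume that $(M,J,g)$ is anti-Kähler, that is, $g(JX,JY)=-g(X,Y)$ for all tangent vectors $X,Y$ at the same point, and $\nabla J=0$. Let $p\in M$ and let $\mathcal E_p\subset T_pM$ be the domain of the exponential map at $p$, i.e. the set of all $v\in T_pM$ such that the geodesic $\gamma_v$ of $g$ with $\gamma_v(0)=p$, $\gamma_v'(0)=v$ is defined up to time $1$; put $\exp_p(v)=\gamma_v(1)$ for $v\in\mathcal E_p$. Then $\mathcal E_p$ is an open subset of $T_pM$ containing $0$, and $\exp_p:(\mathcal E_p,J_p)\to(M,J)$ is holomorphic, where $T_pM$ is regarded as a complex vector space by means of $J_p$. -/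

import Mathlib

open Set Bundle
open scoped Manifold ContDiff Topology

/-! ## Pseudo-Riemannian metrics, Levi-Civita connection, geodesics, exponential map -/

noncomputable section PseudoRiemannian

variable {E : Type*} [NormedAddCommGroup E] [NormedSpace ℝ E]
  {M : Type*} [TopologicalSpace M] [ChartedSpace E M]

/-- A smooth pseudo-Riemannian metric on the smooth manifold `M` (modelled on `E`, without
boundary): a smooth field of symmetric nondegenerate bilinear forms on the tangent spaces. -/
structure PseudoRiemannianMetric (E : Type*) [NormedAddCommGroup E] [NormedSpace ℝ E]
    (M : Type*) [TopologicalSpace M] [ChartedSpace E M] [IsManifold 𝓘(ℝ, E) ∞ M] where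
  /-- the bilinear form on the tangent space at `x` -/
  val (x : M) :
    TangentSpace 𝓘(ℝ, E) x →L[ℝ] TangentSpace 𝓘(ℝ, E) x →L[ℝ] ℝ
  symm (x : M) (v w : TangentSpace 𝓘(ℝ, E) x) : val x v w = val x w v
  nondegenerate (x : M) (v : TangentSpace 𝓘(ℝ, E) x) (hv : ∀ w, val x v w = 0) : v = 0
  contMDiff : ContMDiff 𝓘(ℝ, E) (𝓘(ℝ, E).prod 𝓘(ℝ, E →L[ℝ] E →L[ℝ] ℝ)) ∞
    (fun x ↦ TotalSpace.mk' (E →L[ℝ] E →L[ℝ] ℝ) x (val x))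

variable [IsManifold 𝓘(ℝ, E) ∞ M]

namespace PseudoRiemannianMetric

/-- The metric read in the chart `e`: at a point `y` of `e.target` this is the bilinear form
`(u, w) ↦ g (d(e⁻¹)_y u, d(e⁻¹)_y w)` on `E`, i.e. the "matrix" `(g_ij)` at `y`. -/
def inChart (g : PseudoRiemannianMetric E M) (e : OpenPartialHomeomorph M E) (y : E) :
    E →L[ℝ] E →L[ℝ] ℝ :=
  let D : E →L[ℝ] E := mfderiv 𝓘(ℝ, E) 𝓘(ℝ, E) e.symm y
  let b : E →L[ℝ] E →L[ℝ] ℝ := g.val (e.symm y)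
  b.bilinearComp D D

/-- The Christoffel symbols of the first kind in the chart `e`, as a linear form in the last
argument:
`Γ(u, v; w) = (1/2) ((∂_u G)(v, w) + (∂_v G)(u, w) - (∂_w G)(u, v))` with `G = g.inChart e`. -/
def christoffelFirst (g : PseudoRiemannianMetric E M) (e : OpenPartialHomeomorph M E)
    (y u v : E) : E →L[ℝ] ℝ :=
  let DG := fderiv ℝ (g.inChart e) y
  (1 / 2 : ℝ) • (DG u v + DG v u - (DG.flip u).flip v)

/-- The Christoffel symbols (of the second kind) in the chart `e`: the vector `Γ(u, v)` with
`G(Γ(u, v), w) = Γ(u, v; w)` for all `w`, where `G = g.inChart e`.  (For `y` in the target of a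
chart of the atlas and finite-dimensional `E`, the map `G y : E → E*` is invertible.) -/
def christoffel (g : PseudoRiemannianMetric E M) (e : OpenPartialHomeomorph M E)
    (y u v : E) : E :=
  (g.inChart e y).inverse (g.christoffelFirst e y u v)

/-- The Levi-Civita connection: `g.leviCivita X x v` is `(∇_v X)(x)`, computed in the preferred
chart `e` at `x` as `d(e⁻¹) (∂_{v'} X' + Γ(v', X'))`, where `v'`, `X'` are the representations of
`v` and of the vector field `X` in the chart. -/
def leviCivita (g : PseudoRiemannianMetric E M) (X : Π x : M, TangentSpace 𝓘(ℝ, E) x)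
    (x : M) (v : TangentSpace 𝓘(ℝ, E) x) : TangentSpace 𝓘(ℝ, E) x :=
  let e : OpenPartialHomeomorph M E := chartAt E x
  let v' : E := mfderiv 𝓘(ℝ, E) 𝓘(ℝ, E) e x v
  let X' : E → E := fun y ↦ mfderiv 𝓘(ℝ, E) 𝓘(ℝ, E) e (e.symm y) (X (e.symm y))
  let a : E := fderiv ℝ X' (e x) v' + g.christoffel e (e x) v' (X' (e x))
  let D : E →L[ℝ] E := mfderiv 𝓘(ℝ, E) 𝓘(ℝ, E) e.symm (e x)
  D a

/-- `γ` is a geodesic of `g` on the open set `s` of parameters: it is of class `C²` there (hence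
smooth, by the equation) and satisfies `∇_{γ'} γ' = 0`, that is `c'' + Γ_c(c', c') = 0` for the
representation `c = e ∘ γ` of `γ` in every chart `e` of the atlas. -/
structure IsGeodesicOn (g : PseudoRiemannianMetric E M) (γ : ℝ → M) (s : Set ℝ) : Prop where
  contMDiffOn : ContMDiffOn 𝓘(ℝ, ℝ) 𝓘(ℝ, E) 2 γ s
  equation : ∀ t ∈ s, ∀ e ∈ atlas E M, γ t ∈ e.source →
    deriv (deriv (e ∘ γ)) t
      + g.christoffel e (e (γ t)) (deriv (e ∘ γ) t) (deriv (e ∘ γ) t) = 0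

/-- There is a geodesic `γ`, defined on an open interval containing `[0, 1]`, with
`γ(0) = p`, `γ'(0) = v` and `γ(1) = q`. -/
def ExpTo (g : PseudoRiemannianMetric E M) (p : M) (v : TangentSpace 𝓘(ℝ, E) p) (q : M) : Prop :=
  ∃ (γ : ℝ → M) (ε : ℝ), 0 < ε ∧ g.IsGeodesicOn γ (Ioo (-ε) (1 + ε)) ∧
    (⟨γ 0, mfderiv 𝓘(ℝ, ℝ) 𝓘(ℝ, E) γ 0 (1 : ℝ)⟩ : TangentBundle 𝓘(ℝ, E) M) = ⟨p, v⟩ ∧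
    γ 1 = q

/-- The domain of `exp_p`: the vectors `v ∈ T_p M` such that the geodesic with initial velocity
`v` is defined up to time `1`. -/
def expDomain (g : PseudoRiemannianMetric E M) (p : M) : Set (TangentSpace 𝓘(ℝ, E) p) :=
  {v | ∃ q, g.ExpTo p v q}

open Classical in
/-- The exponential map at `p`: `exp_p v = γ_v(1)` for `v` in `g.expDomain p` (where, on a
Hausdorff manifold, the end point does not depend on the geodesic); the value `p` outside of the
domain is a placeholder. -/
def exp (g : PseudoRiemannianMetric E M) (p : M) (v : TangentSpace 𝓘(ℝ, E) p) : M :=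
  if h : ∃ q, g.ExpTo p v q then h.choose else p

end PseudoRiemannianMetric

end PseudoRiemannian

/-! ## Complex manifolds and anti-Kaehler metrics

A complex structure on `M` is given by a holomorphic atlas: `M` is a charted space over a complex
vector space `E` with `IsManifold 𝓘(ℂ, E) ω M`. -/

noncomputable section AntiKaehler

variable {E : Type*} [NormedAddCommGroup E] [NormedSpace ℂ E]
  {M : Type*} [TopologicalSpace M] [ChartedSpace E M]

/-- The real smooth manifold underlying a complex manifold. -/
instance isManifold_real_of_complex [IsManifold 𝓘(ℂ, E) ω M] : IsManifold 𝓘(ℝ, E) ∞ M := by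
  refine isManifold_of_contDiffOn 𝓘(ℝ, E) ∞ M fun e e' he he' ↦ ?_
  have h := (contDiffGroupoid ω 𝓘(ℂ, E)).compatible he he'
  rw [contDiffGroupoid, mem_groupoid_of_pregroupoid] at h
  have h1 : ContDiffOn ℂ ω (𝓘(ℂ, E) ∘ (e.symm ≫ₕ e') ∘ 𝓘(ℂ, E).symm)
    (𝓘(ℂ, E).symm ⁻¹' (e.symm ≫ₕ e').source ∩ range 𝓘(ℂ, E)) := h.1
  exact (h1.restrict_scalars ℝ).of_le le_top

/-- The complex structure `J` of a complex manifold: on each (real) tangent space, multiplication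
by the imaginary unit in the complex vector space `T_x M`. -/
def complexStructure (x : M) (v : TangentSpace 𝓘(ℝ, E) x) : TangentSpace 𝓘(ℝ, E) x :=
  let w : TangentSpace 𝓘(ℂ, E) x := v
  Complex.I • w

namespace PseudoRiemannianMetric

variable [IsManifold 𝓘(ℂ, E) ω M]

/-- `(M, J, g)` is anti-Kaehler: `g(Jv, Jw) = -g(v, w)`, and `∇J = 0` for the Levi-Civita
connection `∇` of `g`, i.e. `∇_v (J X) = J (∇_v X)`. -/
structure IsAntiKaehler (g : PseudoRiemannianMetric E M) : Prop where
  antiHermitian : ∀ (x : M) (v w : TangentSpace 𝓘(ℝ, E) x),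
    g.val x (complexStructure x v) (complexStructure x w) = -g.val x v w
  parallel : ∀ (X : Π x : M, TangentSpace 𝓘(ℝ, E) x) (x : M),
    MDifferentiableAt 𝓘(ℝ, E) (𝓘(ℝ, E).prod 𝓘(ℝ, E))
      (fun y ↦ (⟨y, X y⟩ : TangentBundle 𝓘(ℝ, E) M)) x →
    ∀ v : TangentSpace 𝓘(ℝ, E) x,
      g.leviCivita (fun y ↦ complexStructure y (X y)) x v
        = complexStructure x (g.leviCivita X x v)

end PseudoRiemannianMetric

end AntiKaehler

/-! Everything rests on one fact: in a holomorphic chart the geodesic equation of an anti-Kähler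
metric is a holomorphic ODE.

Applied to fields with constant coordinates, `∇J = 0` says that `Γ(v, iw) = iΓ(v, w)`; symmetry of
`Γ` then makes it complex bilinear. The relation `g(JX, JY) = -g(X, Y)` says that `G(iu, v) = G(u,
iv)` for the metric `G` in the chart. Compatibility, `∂_a G(u, v) = G(Γ(a, u), v) + G(u, Γ(a, v))`,
therefore lets a factor `i` move freely among the three arguments of the first derivative of `G`,
and, after differentiating once more and using the symmetry of second derivatives, among the four
arguments of the second derivative. Differentiating `G(Γ(u, v), w) = Γ(u, v; w)` then shows that the
differential of `Γ` commutes with `i` (`IsAntiKaehler.fderiv_christoffel_I_smul`), so `Γ` is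
holomorphic.

A holomorphic vector field has a local flow that is holomorphic in the initial condition
(`exists_holomorphic_localFlow`), by the implicit function theorem in a space of continuous curves.
Given `v₀` in the domain of `exp_p`, these local flows are glued along the geodesic of `v₀`
(`IsAntiKaehler.holomorphicUpTo_step`), since changes of chart act holomorphically on positions and
velocities; a supremum argument reaches time `1` (`IsAntiKaehler.holomorphicUpTo`). The result is a
neighbourhood of `v₀` on which the geodesics live past time `1` with end points holomorphic in `v`,
which gives openness and holomorphy together. Uniqueness of geodesics, where the Hausdorff property
enters, identifies these end points with the values of `exp`. -/

/-! ## Local flows of holomorphic vector fields -/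

noncomputable section HolomorphicFlow

namespace ContinuousMap

/-! ### Superposition operators on spaces of continuous functions -/

section Superposition

variable {K F G H : Type*} [TopologicalSpace K] [CompactSpace K]
  [NormedAddCommGroup F] [NormedSpace ℂ F] [NormedAddCommGroup G] [NormedSpace ℂ G]
  [NormedAddCommGroup H] [NormedSpace ℂ H]

/-- Pointwise application of a continuous bilinear map to continuous functions. -/
def pointwiseCLM (B : H →L[ℂ] F →L[ℂ] G) : C(K, H) →L[ℂ] C(K, F) →L[ℂ] C(K, G) :=
  LinearMap.mkContinuous₂
    (LinearMap.mk₂ ℂ (fun (A : C(K, H)) (h : C(K, F)) ↦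
        (⟨fun s ↦ B (A s) (h s), by fun_prop⟩ : C(K, G)))
      (fun _ _ _ ↦ by ext; simp) (fun _ _ _ ↦ by ext; simp)
      (fun _ _ _ ↦ by ext; simp) (fun _ _ _ ↦ by ext; simp)) ‖B‖
    fun A h ↦ by
      rw [ContinuousMap.norm_le _ (by positivity)]
      intro s
      exact (B.le_opNorm₂ _ _).trans (by gcongr <;> exact ContinuousMap.norm_coe_le_norm _ s)

/-- The superposition operator `c ↦ f ∘ c` is differentiable at the functions with values in a
region where `f` is continuously differentiable. -/
lemma hasFDerivAt_comp_left (f : C(F, G)) (B : H →L[ℂ] F →L[ℂ] G) (A : C(F, H))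
    {Ω : Set F} (hΩ : IsOpen Ω)
    (hf : ∀ z ∈ Ω, HasFDerivAt f (B (A z)) z) (c : C(K, F)) (hc : MapsTo c univ Ω) :
    HasFDerivAt (fun c : C(K, F) ↦ f.comp c) (pointwiseCLM B (A.comp c)) c := by
  rw [hasFDerivAt_iff_isLittleO_nhds_zero, Asymptotics.isLittleO_iff]
  intro ε hε
  have h1 : {c' : C(K, F) | MapsTo c' univ Ω} ∈ 𝓝 c :=
    (ContinuousMap.isOpen_setOfPred_mapsTo isCompact_univ hΩ).mem_nhds hc
  have h2 : {c' : C(K, F) | dist (A.comp c') (A.comp c) < ε / (‖B‖ + 1)} ∈ 𝓝 c :=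
    (A.continuous_postcomp.tendsto c).eventually (Metric.ball_mem_nhds _ (by positivity))
  obtain ⟨δ, hδ, hball⟩ := Metric.mem_nhds_iff.1 (Filter.inter_mem h1 h2)
  have key : ∀ s : K, ∀ z ∈ Metric.ball (c s) δ, z ∈ Ω ∧ ‖B (A z) - B (A (c s))‖ ≤ ε := by
    intro s z hz
    -- Shifting `c` by a constant produces a function within `δ` of `c` with the value `z` at `s`.
    -- Neighbourhoods in the function space thus give pointwise estimates that are uniform in `s`.
    have hmem : c + ContinuousMap.const K (z - c s) ∈ Metric.ball c δ := by
      rw [Metric.mem_ball, dist_eq_norm, add_sub_cancel_left]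
      refine lt_of_le_of_lt ((ContinuousMap.norm_le _ (norm_nonneg (z - c s))).2 ?_)
        (mem_ball_iff_norm.1 hz)
      intro; simp
    obtain ⟨hm, hd⟩ := hball hmem
    have e : (c + ContinuousMap.const K (z - c s)) s = z := by simp
    refine ⟨e ▸ hm (mem_univ s), ?_⟩
    have := (ContinuousMap.dist_apply_le_dist s).trans (le_of_lt hd)
    rw [ContinuousMap.comp_apply, ContinuousMap.comp_apply, e, dist_eq_norm,
      le_div_iff₀ (by positivity)] at this
    rw [← map_sub]
    refine (B.le_opNorm _).trans ?_
    nlinarith [norm_nonneg (A z - A (c s))]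
  filter_upwards [Metric.ball_mem_nhds (0 : C(K, F)) hδ] with h hh
  rw [ContinuousMap.norm_le _ (by positivity)]
  intro s
  have hs : ‖h s‖ < δ := (h.norm_coe_le_norm s).trans_lt (mem_ball_zero_iff.1 hh)
  have := (convex_ball (c s) δ).norm_image_sub_le_of_norm_hasFDerivWithin_le'
    (𝕜 := ℂ) (f := f) (f' := fun z ↦ B (A z)) (φ := B (A (c s))) (C := ε) (x := c s) (y := c s + h s)
    (fun z hz ↦ (hf z (key s z hz).1).hasFDerivWithinAt) (fun z hz ↦ (key s z hz).2)
    (Metric.mem_ball_self hδ) (by simpa using hs)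
  simp only [add_sub_cancel_left] at this
  exact this.trans (mul_le_mul_of_nonneg_left (h.norm_coe_le_norm s) hε.le)

/-- The derivative at `c` is built from `A ∘ c`, which is continuous in `c`. Taking `f` and `A`
globally continuous keeps both composites inside spaces of continuous maps even where `f` is not
differentiable. -/
lemma contDiffAt_comp_left (f : C(F, G)) (B : H →L[ℂ] F →L[ℂ] G) (A : C(F, H))
    {Ω : Set F} (hΩ : IsOpen Ω)
    (hf : ∀ z ∈ Ω, HasFDerivAt f (B (A z)) z) (c : C(K, F)) (hc : MapsTo c univ Ω) :
    ContDiffAt ℂ 1 (fun c : C(K, F) ↦ f.comp c) c :=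
  contDiffAt_one_iff.2 ⟨fun c ↦ pointwiseCLM B (A.comp c), {c' : C(K, F) | MapsTo c' univ Ω},
    (ContinuousMap.isOpen_setOfPred_mapsTo isCompact_univ hΩ).mem_nhds hc,
    ((pointwiseCLM B).continuous.comp A.continuous_postcomp).continuousOn,
    fun c hc ↦ hasFDerivAt_comp_left f B A hΩ hf c hc⟩

end Superposition

/-! ### The integration operator on `[-1, 1]` -/

section Volterra

variable {F : Type*} [NormedAddCommGroup F] [NormedSpace ℂ F]

/-- The operator `c ↦ (s ↦ ∫₀ˢ c)` on the continuous functions on `[-1, 1]`. -/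
def volterra : C(Icc (-1 : ℝ) 1, F) →L[ℂ] C(Icc (-1 : ℝ) 1, F) :=
  LinearMap.mkContinuous
    { toFun c := ⟨fun s ↦ ∫ x in (0 : ℝ)..s, Set.IccExtend (by norm_num) c x,
        (intervalIntegral.continuous_primitive
          (fun _ _ ↦ (c.continuous.Icc_extend').intervalIntegrable _ _) 0).comp
          continuous_subtype_val⟩
      map_add' c d := by
        ext s
        exact intervalIntegral.integral_add ((c.continuous.Icc_extend').intervalIntegrable _ _)
          ((d.continuous.Icc_extend').intervalIntegrable _ _)
      map_smul' k c := by
        ext s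
        exact intervalIntegral.integral_smul k _ } 1
    fun c ↦ by
      rw [ContinuousMap.norm_le _ (by positivity), one_mul]
      intro s
      have h := intervalIntegral.norm_integral_le_of_norm_le_const
        (f := Set.IccExtend (by norm_num : (-1 : ℝ) ≤ 1) c) (a := 0) (b := s) (C := ‖c‖)
        fun x _ ↦ c.norm_coe_le_norm _
      refine h.trans (mul_le_of_le_one_right (norm_nonneg _) ?_)
      rw [sub_zero, abs_le]
      exact s.2

lemma hasDerivAt_volterra [CompleteSpace F] (c : C(Icc (-1 : ℝ) 1, F)) {t : ℝ}
    (ht : t ∈ Ioo (-1 : ℝ) 1) :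
    HasDerivAt (Set.IccExtend (by norm_num : (-1 : ℝ) ≤ 1) (volterra c))
      (c ⟨t, Ioo_subset_Icc_self ht⟩) t := by
  have h := intervalIntegral.integral_hasDerivAt_right
    ((c.continuous.Icc_extend' (h := (by norm_num : (-1 : ℝ) ≤ 1))).intervalIntegrable 0 t)
    ((c.continuous.Icc_extend').stronglyMeasurableAtFilter _ _)
    (c.continuous.Icc_extend').continuousAt
  rw [IccExtend_of_mem _ _ (Ioo_subset_Icc_self ht)] at h
  refine h.congr_of_eventuallyEq ?_
  filter_upwards [isOpen_Ioo.mem_nhds ht] with x hx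
  rw [IccExtend_of_mem _ _ (Ioo_subset_Icc_self hx)]
  rfl

@[simp] lemma volterra_zero (c : C(Icc (-1 : ℝ) 1, F)) :
    volterra c ⟨0, by norm_num⟩ = 0 :=
  intervalIntegral.integral_same

end Volterra

end ContinuousMap

/-! ### Holomorphic dependence on the initial condition -/

open ContinuousMap in
/-- A holomorphic vector field has a local flow, holomorphic in the initial condition. -/
theorem exists_holomorphic_localFlow {F : Type*} [NormedAddCommGroup F] [NormedSpace ℂ F]
    [FiniteDimensional ℂ F] {f : F → F} {Ω : Set F} (hΩ : IsOpen Ω) (hf : ContDiffOn ℂ 1 f Ω)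
    {z₀ : F} (hz₀ : z₀ ∈ Ω) :
    ∃ τ : ℝ, 0 < τ ∧ ∃ V : Set F, IsOpen V ∧ z₀ ∈ V ∧ ∃ Φ : F → ℝ → F, ∀ z ∈ V,
      Φ z 0 = z ∧ ∀ t ∈ Ioo (-τ) τ, Φ z t ∈ Ω ∧ HasDerivAt (Φ z) (f (Φ z t)) t ∧
        DifferentiableAt ℂ (fun z ↦ Φ z t) z := by
  have : CompleteSpace F := FiniteDimensional.complete ℂ F
  obtain ⟨r, hr, hrΩ⟩ := Metric.nhds_basis_closedBall.mem_iff.1 (hΩ.mem_nhds hz₀)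
  -- Tietze extension of `f` and its derivative from a closed ball: composition with all curves is
  -- then defined, and the solutions found below stay in the ball.
  obtain ⟨f', hf'⟩ := ContinuousMap.exists_restrict_eq (Metric.isClosed_closedBall (x := z₀) (ε := r))
    ⟨(Metric.closedBall z₀ r).domRestrict f, (hf.continuousOn.mono hrΩ).domRestrict⟩
  obtain ⟨A, hA⟩ := ContinuousMap.exists_restrict_eq (Metric.isClosed_closedBall (x := z₀) (ε := r))
    ⟨(Metric.closedBall z₀ r).domRestrict (fderiv ℂ f),
      ((hf.continuousOn_fderiv_of_isOpen hΩ le_rfl).mono hrΩ).domRestrict⟩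
  have hff' : EqOn f' f (Metric.closedBall z₀ r) := fun z hz ↦ DFunLike.congr_fun hf' ⟨z, hz⟩
  have hAf : EqOn A (fderiv ℂ f) (Metric.closedBall z₀ r) :=
    fun z hz ↦ DFunLike.congr_fun hA ⟨z, hz⟩
  have hderiv : ∀ z ∈ Metric.ball z₀ r, HasFDerivAt f' (ContinuousLinearMap.id ℂ _ (A z)) z := by
    intro z hz
    have hz' := Metric.ball_subset_closedBall hz
    rw [ContinuousLinearMap.id_apply, hAf hz']
    refine ((hf.contDiffAt (hΩ.mem_nhds (hrΩ hz'))).differentiableAt one_ne_zero).hasFDerivAt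
      |>.congr_of_eventuallyEq ?_
    filter_upwards [Metric.isOpen_ball.mem_nhds hz] with x hx
    exact hff' (Metric.ball_subset_closedBall hx)
  let X := C(Icc (-1 : ℝ) 1, F)
  let cst : F →L[ℂ] X := LinearMap.mkContinuous
    { toFun := ContinuousMap.const _, map_add' := fun _ _ ↦ rfl, map_smul' := fun _ _ ↦ rfl } 1
    fun z ↦ by
      rw [ContinuousMap.norm_le _ (by positivity), one_mul]
      intro s; exact le_rfl
  -- A zero is a curve with `c(s) = z + μ ∫₀ˢ f'(c)`, that is, a solution of the ODE run at speed
  -- `μ`. Making the speed a complex parameter turns short time into small `μ` on a fixed interval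
  -- and keeps `Ψ` complex differentiable.
  let Ψ : (F × ℂ) × X → X := fun x ↦ x.2 - cst x.1.1 - x.1.2 • volterra (f'.comp x.2)
  let u : (F × ℂ) × X := ((z₀, 0), cst z₀)
  have hcst : MapsTo (cst z₀) univ (Metric.ball z₀ r) := fun s _ ↦ Metric.mem_ball_self hr
  have hsup : ContDiffAt ℂ 1 (fun x : (F × ℂ) × X ↦ f'.comp x.2) u :=
    (contDiffAt_comp_left f' (ContinuousLinearMap.id ℂ _) A Metric.isOpen_ball hderiv (cst z₀)
      hcst).comp u contDiffAt_snd
  have hvol : ContDiffAt ℂ 1 (fun x : (F × ℂ) × X ↦ volterra (f'.comp x.2)) u :=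
    (volterra (F := F)).contDiff.contDiffAt.comp u hsup
  have hΨ : ContDiffAt ℂ 1 Ψ u := by
    refine (contDiffAt_snd.sub (cst.contDiff.contDiffAt.comp u ?_)).sub
      (ContDiffAt.smul (f := fun x : (F × ℂ) × X ↦ x.1.2) ?_ hvol) <;> fun_prop
  -- At `μ = 0` the integral term vanishes, so the partial derivative in the curve is the identity
  -- and the implicit function theorem applies.
  have hinr : fderiv ℂ Ψ u ∘L .inr ℂ (F × ℂ) X = ContinuousLinearMap.id ℂ X := by
    have h1 : HasFDerivAt (fun c : X ↦ Ψ ((z₀, 0), c)) (fderiv ℂ Ψ u ∘L .inr ℂ (F × ℂ) X)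
        (cst z₀) :=
      ((hΨ.differentiableAt one_ne_zero).hasFDerivAt).comp (cst z₀)
        (hasFDerivAt_prodMk_right (z₀, (0 : ℂ)) (cst z₀))
    have h2 : (fun c : X ↦ Ψ ((z₀, 0), c)) = fun c ↦ c - cst z₀ := by
      funext c; simp [Ψ]
    rw [h2] at h1
    exact h1.unique ((hasFDerivAt_id _).sub_const _)
  have hinv : (fderiv ℂ Ψ u ∘L .inr ℂ (F × ℂ) X).IsInvertible :=
    hinr ▸ ⟨ContinuousLinearEquiv.refl ℂ X, rfl⟩
  let ψ := hΨ.implicitFunction one_ne_zero hinv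
  have hψ0 : ψ (z₀, 0) = cst z₀ := hΨ.implicitFunction_apply_self one_ne_zero hinv
  have hψ1 : ContDiffAt ℂ 1 ψ (z₀, 0) := hΨ.contDiffAt_implicitFunction one_ne_zero hinv
  have hΨu : Ψ u = 0 := by simp [Ψ, u]
  have e1 : ∀ᶠ x in 𝓝 (z₀, (0 : ℂ)), Ψ (x, ψ x) = 0 :=
    hΨu ▸ hΨ.eventually_apply_implicitFunction one_ne_zero hinv
  have e2 : ∀ᶠ x in 𝓝 (z₀, (0 : ℂ)), DifferentiableAt ℂ ψ x :=
    (hψ1.eventually (by simp)).mono fun x hx ↦ hx.differentiableAt one_ne_zero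
  have e3 : ∀ᶠ x in 𝓝 (z₀, (0 : ℂ)), MapsTo (ψ x) univ (Metric.ball z₀ r) :=
    hψ1.continuousAt.eventually
      ((ContinuousMap.isOpen_setOfPred_mapsTo isCompact_univ Metric.isOpen_ball).mem_nhds
        (hψ0 ▸ hcst))
  have e := e1.and (e2.and e3)
  rw [nhds_prod_eq] at e
  obtain ⟨p, hp, q, hq, hpq⟩ := Filter.eventually_prod_iff.1 e
  obtain ⟨V, hVp, hV, hzV⟩ := eventually_nhds_iff.1 hp
  obtain ⟨ρ, hρ, hρq⟩ := Metric.eventually_nhds_iff.1 hq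
  have hτ : (0 : ℝ) < ρ / 2 := by positivity
  generalize hτd : ρ / 2 = τ at hτ
  have hqτ : q (τ : ℂ) := hρq (by
    rw [dist_zero_right, Complex.norm_real, Real.norm_of_nonneg hτ.le]; linarith)
  have h11 : (-1 : ℝ) ≤ 1 := by norm_num
  -- With the speed fixed at `τ`, the division `t / τ` undoes the rescaling of time.
  refine ⟨τ, hτ, V, hV, hzV, fun z t ↦ Set.IccExtend h11 (ψ (z, (τ : ℂ))) (t / τ), fun z hz ↦ ?_⟩
  obtain ⟨heq, hdiff, hmaps⟩ := hpq (hVp z hz) hqτ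
  have heq' : ψ (z, (τ : ℂ)) = cst z + (τ : ℂ) • volterra (f'.comp (ψ (z, (τ : ℂ)))) := by
    have : ψ (z, (τ : ℂ)) - cst z - (τ : ℂ) • volterra (f'.comp (ψ (z, (τ : ℂ)))) = 0 := heq
    rwa [sub_sub, sub_eq_zero] at this
  have hval : ∀ s, ψ (z, (τ : ℂ)) s = z + (τ : ℂ) • volterra (f'.comp (ψ (z, (τ : ℂ)))) s :=
    fun s ↦ DFunLike.congr_fun heq' s
  refine ⟨?_, fun t ht ↦ ?_⟩
  · simp only [zero_div]
    rw [IccExtend_of_mem _ _ (by norm_num : (0 : ℝ) ∈ Icc (-1 : ℝ) 1), hval, volterra_zero,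
      smul_zero, add_zero]
  · have htτ : t / τ ∈ Ioo (-1 : ℝ) 1 := by
      constructor
      · rw [lt_div_iff₀ hτ]; linarith [ht.1]
      · rw [div_lt_iff₀ hτ]; linarith [ht.2]
    have hmem : Set.IccExtend h11 (ψ (z, (τ : ℂ))) (t / τ) ∈ Metric.ball z₀ r :=
      hmaps (mem_univ _)
    refine ⟨hrΩ (Metric.ball_subset_closedBall hmem), ?_, ?_⟩
    · have h1 := hasDerivAt_volterra (f'.comp (ψ (z, (τ : ℂ)))) htτ
      have h2 := ((h1.scomp t ((hasDerivAt_id t).div_const τ)).const_smul (τ : ℂ)).const_add z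
      have h3 : f (Set.IccExtend h11 (ψ (z, (τ : ℂ))) (t / τ)) = (τ : ℂ) • (1 / τ) •
          (f'.comp (ψ (z, (τ : ℂ)))) ⟨t / τ, Ioo_subset_Icc_self htτ⟩ := by
        rw [← hff' (Metric.ball_subset_closedBall hmem),
          IccExtend_of_mem _ _ (Ioo_subset_Icc_self htτ), Complex.coe_smul, smul_smul,
          mul_one_div_cancel hτ.ne', one_smul]
        rfl
      rw [h3]
      refine h2.congr_of_eventuallyEq (Filter.Eventually.of_forall fun x ↦ hval _)
    · have h1 : DifferentiableAt ℂ (fun z ↦ ψ (z, (τ : ℂ))) z :=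
        hdiff.comp z (by fun_prop : DifferentiableAt ℂ (fun z ↦ (z, (τ : ℂ))) z)
      exact (ContinuousMap.evalCLM ℂ (projIcc (-1 : ℝ) 1 h11 (t / τ))).differentiableAt.comp z h1

end HolomorphicFlow

/-! ### Metric and Christoffel symbols in charts, and their transformation laws -/

noncomputable section MetricInCharts

set_option maxSynthPendingDepth 3

section ChartDerivatives

variable {E : Type*} [NormedAddCommGroup E] [NormedSpace ℝ E]
  {M : Type*} [TopologicalSpace M] [ChartedSpace E M] [IsManifold 𝓘(ℝ, E) ∞ M]
  {e e' : OpenPartialHomeomorph M E}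

lemma mdifferentiable_of_mem_atlas_real (he : e ∈ atlas E M) :
    e.MDifferentiable 𝓘(ℝ, E) 𝓘(ℝ, E) :=
  have : IsManifold 𝓘(ℝ, E) 1 M := .of_le (n := ∞) (by simp)
  mdifferentiable_of_mem_atlas he

lemma mfderiv_symm_mfderiv (he : e ∈ atlas E M) {x : M} (hx : x ∈ e.source)
    (v : TangentSpace 𝓘(ℝ, E) x) :
    mfderiv 𝓘(ℝ, E) 𝓘(ℝ, E) e.symm (e x) (mfderiv 𝓘(ℝ, E) 𝓘(ℝ, E) e x v) = v :=
  DFunLike.congr_fun ((mdifferentiable_of_mem_atlas_real he).symm_comp_deriv hx) v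

lemma mfderiv_mfderiv_symm (he : e ∈ atlas E M) {y : E} (hy : y ∈ e.target) (v : E) :
    mfderiv 𝓘(ℝ, E) 𝓘(ℝ, E) e (e.symm y) (mfderiv 𝓘(ℝ, E) 𝓘(ℝ, E) e.symm y v) = v :=
  DFunLike.congr_fun ((mdifferentiable_of_mem_atlas_real he).comp_symm_deriv hy) v

/-- The tangent space at `x` is by construction `E`, identified through the preferred chart at `x`.
-/
lemma mfderiv_chartAt_self (x : M) (v : TangentSpace 𝓘(ℝ, E) x) :
    mfderiv 𝓘(ℝ, E) 𝓘(ℝ, E) (chartAt E x) x v = v := by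
  have : IsManifold 𝓘(ℝ, E) 1 M := .of_le (n := ∞) (by simp)
  rw [mfderiv_chartAt_eq_tangentCoordChange (mem_chart_source E x)]
  exact tangentCoordChange_self (I := 𝓘(ℝ, E)) (x := x) (z := x) (v := (show E from v))
    (mem_extChartAt_source x)

/-- The coordinate vector fields of a chart are smooth. -/
lemma contMDiffOn_mfderiv_chart_symm (he : e ∈ atlas E M) (u : E) :
    ContMDiffOn 𝓘(ℝ, E) (𝓘(ℝ, E).prod 𝓘(ℝ, E)) ∞
      (fun y : E ↦ (⟨e.symm y, mfderiv 𝓘(ℝ, E) 𝓘(ℝ, E) e.symm y u⟩ : TangentBundle 𝓘(ℝ, E) M))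
      e.target := by
  have h1 : ContMDiffOn 𝓘(ℝ, E) 𝓘(ℝ, E) ∞ e.symm e.target :=
    contMDiffOn_symm_of_mem_maximalAtlas (IsManifold.subset_maximalAtlas he)
  have h2 := h1.contMDiffOn_tangentMapWithin (m := ∞) (by simp)
    e.open_target.uniqueMDiffOn
  have h3 : ContMDiff 𝓘(ℝ, E) (𝓘(ℝ, E).prod 𝓘(ℝ, E)) ∞
      (fun y : E ↦ (⟨y, u⟩ : TangentBundle 𝓘(ℝ, E) E)) :=
    contMDiff_vectorSpace_iff_contDiff.2 contDiff_const
  refine (h2.comp h3.contMDiffOn (fun y hy ↦ hy)).congr fun y hy ↦ ?_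
  simp only [Function.comp_apply, tangentMapWithin,
    mfderivWithin_of_isOpen e.open_target hy]

variable (e e') in
/-- The coordinate change between two charts. -/
abbrev coordChange : E → E := e' ∘ e.symm

lemma contDiffOn_coordChange (he : e ∈ atlas E M) (he' : e' ∈ atlas E M) :
    ContDiffOn ℝ ∞ (coordChange e e') (e.symm ≫ₕ e').source := by
  rw [← contMDiffOn_iff_contDiffOn]
  have h1 : ContMDiffOn 𝓘(ℝ, E) 𝓘(ℝ, E) ∞ e.symm e.target :=
    contMDiffOn_symm_of_mem_maximalAtlas (IsManifold.subset_maximalAtlas he)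
  have h2 : ContMDiffOn 𝓘(ℝ, E) 𝓘(ℝ, E) ∞ e' e'.source :=
    contMDiffOn_of_mem_maximalAtlas (IsManifold.subset_maximalAtlas he')
  refine h2.comp (h1.mono ?_) ?_
  · intro y hy; simp at hy; exact hy.1
  · intro y hy; simp at hy; exact hy.2

lemma contDiffAt_coordChange (he : e ∈ atlas E M) (he' : e' ∈ atlas E M) {y : E}
    (hy : y ∈ (e.symm ≫ₕ e').source) : ContDiffAt ℝ ∞ (coordChange e e') y :=
  (contDiffOn_coordChange he he').contDiffAt ((e.symm ≫ₕ e').open_source.mem_nhds hy)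

lemma fderiv_coordChange (he : e ∈ atlas E M) (he' : e' ∈ atlas E M) {y : E}
    (hy : y ∈ (e.symm ≫ₕ e').source) (v : E) : fderiv ℝ (coordChange e e') y v =
      mfderiv 𝓘(ℝ, E) 𝓘(ℝ, E) e' (e.symm y) (mfderiv 𝓘(ℝ, E) 𝓘(ℝ, E) e.symm y v) := by
  have hy1 : y ∈ e.target := by simp at hy; exact hy.1
  have hy2 : e.symm y ∈ e'.source := by simp at hy; exact hy.2
  rw [← mfderiv_eq_fderiv, coordChange,
    mfderiv_comp y ((mdifferentiable_of_mem_atlas_real he').mdifferentiableAt hy2)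
      ((mdifferentiable_of_mem_atlas_real he).mdifferentiableAt_symm hy1)]
  rfl

lemma mfderiv_symm_fderiv_coordChange (he : e ∈ atlas E M) (he' : e' ∈ atlas E M) {y : E}
    (hy : y ∈ (e.symm ≫ₕ e').source) (v : E) :
    mfderiv 𝓘(ℝ, E) 𝓘(ℝ, E) e'.symm (coordChange e e' y) (fderiv ℝ (coordChange e e') y v) =
      mfderiv 𝓘(ℝ, E) 𝓘(ℝ, E) e.symm y v := by
  rw [fderiv_coordChange he he' hy]
  exact mfderiv_symm_mfderiv he' (by simp at hy; exact hy.2) _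

lemma fderiv_coordChange_bijective (he : e ∈ atlas E M) (he' : e' ∈ atlas E M) {y : E}
    (hy : y ∈ (e.symm ≫ₕ e').source) :
    Function.Bijective (fderiv ℝ (coordChange e e') y) := by
  have hy1 : y ∈ e.target := by simp at hy; exact hy.1
  have hy2 : e.symm y ∈ e'.source := by simp at hy; exact hy.2
  constructor
  · intro v w hvw
    have := mfderiv_symm_fderiv_coordChange he he' hy v
    rw [hvw, mfderiv_symm_fderiv_coordChange he he' hy w] at this
    rw [← mfderiv_mfderiv_symm he hy1 v, ← mfderiv_mfderiv_symm he hy1 w, this]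
  · intro w
    refine ⟨mfderiv 𝓘(ℝ, E) 𝓘(ℝ, E) e (e.symm y)
      (mfderiv 𝓘(ℝ, E) 𝓘(ℝ, E) e'.symm (e' (e.symm y)) w), ?_⟩
    refine (fderiv_coordChange he he' hy _).trans ?_
    have h1 := mfderiv_symm_mfderiv he (e.map_target hy1)
      (mfderiv 𝓘(ℝ, E) 𝓘(ℝ, E) e'.symm (e' (e.symm y)) w)
    rw [e.right_inv hy1] at h1
    have h2 := mfderiv_mfderiv_symm he' (e'.map_source hy2) w
    rw [e'.left_inv hy2] at h2
    exact (congrArg _ h1).trans h2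

end ChartDerivatives

namespace PseudoRiemannianMetric

variable {E : Type*} [NormedAddCommGroup E] [NormedSpace ℝ E]
  {M : Type*} [TopologicalSpace M] [ChartedSpace E M] [IsManifold 𝓘(ℝ, E) ∞ M]
  (g : PseudoRiemannianMetric E M) {e e' : OpenPartialHomeomorph M E}

lemma inChart_apply (e : OpenPartialHomeomorph M E) (y u v : E) :
    g.inChart e y u v = g.val (e.symm y) (mfderiv 𝓘(ℝ, E) 𝓘(ℝ, E) e.symm y u)
      (mfderiv 𝓘(ℝ, E) 𝓘(ℝ, E) e.symm y v) := rfl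

lemma inChart_symm (e : OpenPartialHomeomorph M E) (y u v : E) :
    g.inChart e y u v = g.inChart e y v u :=
  g.symm (e.symm y) (mfderiv 𝓘(ℝ, E) 𝓘(ℝ, E) e.symm y u) (mfderiv 𝓘(ℝ, E) 𝓘(ℝ, E) e.symm y v)

lemma inChart_nondegenerate (he : e ∈ atlas E M) {y : E} (hy : y ∈ e.target) {u : E}
    (hu : ∀ v, g.inChart e y u v = 0) : u = 0 := by
  have h1 : mfderiv 𝓘(ℝ, E) 𝓘(ℝ, E) e.symm y u = 0 := by
    refine g.nondegenerate _ _ fun w ↦ ?_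
    have h2 := mfderiv_symm_mfderiv he (e.map_target hy) w
    rw [e.right_inv hy] at h2
    rw [← h2]
    exact hu _
  exact (mfderiv_mfderiv_symm he hy u).symm.trans ((congrArg _ h1).trans (map_zero _))

lemma inChart_injective (he : e ∈ atlas E M) {y : E} (hy : y ∈ e.target) {u v : E}
    (h : ∀ w, g.inChart e y u w = g.inChart e y v w) : u = v :=
  sub_eq_zero.1 (g.inChart_nondegenerate he hy fun w ↦ by simp [h w])

lemma inChart_coordChange (he : e ∈ atlas E M) (he' : e' ∈ atlas E M) {y : E}
    (hy : y ∈ (e.symm ≫ₕ e').source) (u v : E) :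
    g.inChart e y u v = g.inChart e' (coordChange e e' y)
      (fderiv ℝ (coordChange e e') y u) (fderiv ℝ (coordChange e e') y v) := by
  have hx : e'.symm (coordChange e e' y) = e.symm y :=
    e'.left_inv (by simp at hy; exact hy.2)
  rw [inChart_apply, inChart_apply, mfderiv_symm_fderiv_coordChange he he' hy,
    mfderiv_symm_fderiv_coordChange he he' hy, hx]

lemma christoffelFirst_apply (e : OpenPartialHomeomorph M E) (y u v w : E) :
    g.christoffelFirst e y u v w = (1 / 2 : ℝ) * (fderiv ℝ (g.inChart e) y u v w
      + fderiv ℝ (g.inChart e) y v u w - fderiv ℝ (g.inChart e) y w u v) := rfl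

variable [FiniteDimensional ℝ E]

/-- In finite dimension it is enough to evaluate on fixed vectors, where the metric is applied to
smooth coordinate fields. -/
lemma contDiffOn_inChart (he : e ∈ atlas E M) : ContDiffOn ℝ ∞ (g.inChart e) e.target := by
  refine contDiffOn_clm_apply.2 fun u ↦ contDiffOn_clm_apply.2 fun v ↦ ?_
  have hs : ContMDiffOn 𝓘(ℝ, E) 𝓘(ℝ, E) ∞ e.symm e.target :=
    contMDiffOn_symm_of_mem_maximalAtlas (IsManifold.subset_maximalAtlas he)
  have : ContMDiffOn 𝓘(ℝ, E) (𝓘(ℝ, E).prod 𝓘(ℝ)) ∞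
      (fun y ↦ TotalSpace.mk' ℝ (E := Bundle.Trivial M ℝ) (e.symm y)
        (g.val (e.symm y) (mfderiv 𝓘(ℝ, E) 𝓘(ℝ, E) e.symm y u)
          (mfderiv 𝓘(ℝ, E) 𝓘(ℝ, E) e.symm y v))) e.target := by
    apply ContMDiffOn.clm_bundle_apply₂ (F₁ := E) (F₂ := E)
    · exact g.contMDiff.comp_contMDiffOn hs
    · exact contMDiffOn_mfderiv_chart_symm he u
    · exact contMDiffOn_mfderiv_chart_symm he v
  rw [← contMDiffOn_iff_contDiffOn]
  intro y hy
  have h := this y hy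
  simp only [contMDiffWithinAt_totalSpace] at h
  exact h.2

lemma isInvertible_inChart (he : e ∈ atlas E M) {y : E} (hy : y ∈ e.target) :
    (g.inChart e y).IsInvertible := by
  have hinj : Function.Injective (g.inChart e y) :=
    fun u v h ↦ g.inChart_injective he hy fun w ↦ by rw [h]
  have hdim : Module.finrank ℝ E = Module.finrank ℝ (E →L[ℝ] ℝ) := by
    rw [← (LinearMap.toContinuousLinearMap (𝕜 := ℝ) (E := E) (F' := ℝ)).finrank_eq]
    exact Subspace.dual_finrank_eq.symm
  exact ⟨(LinearEquiv.ofInjectiveOfFinrankEq (g.inChart e y : E →ₗ[ℝ] E →L[ℝ] ℝ) hinj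
    hdim).toContinuousLinearEquiv, by ext; rfl⟩

lemma contDiffAt_inChart (he : e ∈ atlas E M) {y : E} (hy : y ∈ e.target) :
    ContDiffAt ℝ ∞ (g.inChart e) y :=
  (g.contDiffOn_inChart he).contDiffAt (e.open_target.mem_nhds hy)

lemma hasFDerivAt_inChart (he : e ∈ atlas E M) {y : E} (hy : y ∈ e.target) :
    HasFDerivAt (g.inChart e) (fderiv ℝ (g.inChart e) y) y :=
  ((g.contDiffAt_inChart he hy).differentiableAt (by simp)).hasFDerivAt

lemma inChart_christoffel (he : e ∈ atlas E M) {y : E} (hy : y ∈ e.target) (u v w : E) :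
    g.inChart e y (g.christoffel e y u v) w = g.christoffelFirst e y u v w := by
  rw [christoffel, (g.isInvertible_inChart he hy).self_apply_inverse]

lemma contDiffOn_christoffel (he : e ∈ atlas E M) :
    ContDiffOn ℝ ∞ (fun z : E × E × E ↦ g.christoffel e z.1 z.2.1 z.2.2)
      (e.target ×ˢ univ) := by
  have : CompleteSpace E := FiniteDimensional.complete ℝ E
  have hfst : MapsTo (Prod.fst : E × E × E → E) (e.target ×ˢ univ) e.target := fun z hz ↦ hz.1
  have hG : ContDiffOn ℝ ∞ (fun z : E × E × E ↦ g.inChart e z.1) (e.target ×ˢ univ) :=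
    (g.contDiffOn_inChart he).comp contDiffOn_fst hfst
  have hD : ContDiffOn ℝ ∞ (fun z : E × E × E ↦ fderiv ℝ (g.inChart e) z.1) (e.target ×ˢ univ) :=
    ((g.contDiffOn_inChart he).fderiv_of_isOpen (m := ∞) e.open_target (by simp)).comp contDiffOn_fst hfst
  have hu : ContDiffOn ℝ ∞ (fun z : E × E × E ↦ z.2.1) (e.target ×ˢ univ) := by fun_prop
  have hv : ContDiffOn ℝ ∞ (fun z : E × E × E ↦ z.2.2) (e.target ×ˢ univ) := by fun_prop
  have hinv : ContDiffOn ℝ ∞ (fun z : E × E × E ↦ (g.inChart e z.1).inverse)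
      (e.target ×ˢ univ) := fun z hz ↦
    ContDiffAt.comp_contDiffWithinAt (g := ContinuousLinearMap.inverse) z
      (g.isInvertible_inChart he hz.1).contDiffAt_map_inverse (hG z hz)
  have flip : ∀ {T : E × E × E → E →L[ℝ] E →L[ℝ] ℝ}, ContDiffOn ℝ ∞ T (e.target ×ˢ univ) →
      ContDiffOn ℝ ∞ (fun z ↦ (T z).flip) (e.target ×ˢ univ) := fun hT ↦
    (ContinuousLinearMap.flipₗᵢ ℝ E E ℝ).toContinuousLinearEquiv.contDiff.comp_contDiffOn hT
  have flip' : ContDiffOn ℝ ∞ (fun z : E × E × E ↦ (fderiv ℝ (g.inChart e) z.1).flip)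
      (e.target ×ˢ univ) :=
    (ContinuousLinearMap.flipₗᵢ ℝ E E (E →L[ℝ] ℝ)).toContinuousLinearEquiv.contDiff.comp_contDiffOn hD
  exact hinv.clm_apply (((((hD.clm_apply hu).clm_apply hv).add
    ((hD.clm_apply hv).clm_apply hu)).sub ((flip (flip'.clm_apply hu)).clm_apply hv)).const_smul
      (1 / 2 : ℝ))

/-- The transformation law of the derivatives of a metric under a change of coordinates. -/
lemma fderiv_inChart_coordChange (he : e ∈ atlas E M) (he' : e' ∈ atlas E M) {y : E}
    (hy : y ∈ (e.symm ≫ₕ e').source) (a u v : E) :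
    fderiv ℝ (g.inChart e) y a u v =
      fderiv ℝ (g.inChart e') (coordChange e e' y) (fderiv ℝ (coordChange e e') y a)
          (fderiv ℝ (coordChange e e') y u) (fderiv ℝ (coordChange e e') y v)
        + g.inChart e' (coordChange e e' y) (fderiv ℝ (fderiv ℝ (coordChange e e')) y a u)
          (fderiv ℝ (coordChange e e') y v)
        + g.inChart e' (coordChange e e' y) (fderiv ℝ (coordChange e e') y u)
          (fderiv ℝ (fderiv ℝ (coordChange e e')) y a v) := by
  have hy1 : y ∈ e.target := by simp at hy; exact hy.1
  have hy2 : coordChange e e' y ∈ e'.target := e'.map_source (by simp at hy; exact hy.2)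
  have hφ := contDiffAt_coordChange he he' hy
  have h1 : HasFDerivAt (coordChange e e') (fderiv ℝ (coordChange e e') y) y :=
    (hφ.differentiableAt (by simp)).hasFDerivAt
  have h2 : HasFDerivAt (fderiv ℝ (coordChange e e')) (fderiv ℝ (fderiv ℝ (coordChange e e')) y) y :=
    ((hφ.fderiv_right (m := 1) (by norm_num; exact ENat.LEInfty.out)).differentiableAt one_ne_zero).hasFDerivAt
  have h3 := (g.hasFDerivAt_inChart he' hy2).comp y h1
  have hl := (((g.hasFDerivAt_inChart he hy1).clm_apply (hasFDerivAt_const u y)).clm_apply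
    (hasFDerivAt_const v y))
  have hr := (h3.clm_apply (h2.clm_apply (hasFDerivAt_const u y))).clm_apply
    (h2.clm_apply (hasFDerivAt_const v y))
  have heq := hl.unique (hr.congr_of_eventuallyEq (by
    filter_upwards [(e.symm ≫ₕ e').open_source.mem_nhds hy] with x hx
    exact g.inChart_coordChange he he' hx u v))
  have := DFunLike.congr_fun heq a
  simp at this
  rw [this]
  simp only [Function.comp_apply]
  ring

/-- The transformation law of the Christoffel symbols under a change of coordinates. -/
lemma fderiv_coordChange_christoffel (he : e ∈ atlas E M) (he' : e' ∈ atlas E M) {y : E}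
    (hy : y ∈ (e.symm ≫ₕ e').source) (u v : E) :
    fderiv ℝ (coordChange e e') y (g.christoffel e y u v) =
      g.christoffel e' (coordChange e e' y) (fderiv ℝ (coordChange e e') y u)
          (fderiv ℝ (coordChange e e') y v)
        + fderiv ℝ (fderiv ℝ (coordChange e e')) y u v := by
  have hy1 : y ∈ e.target := by simp at hy; exact hy.1
  have hy2 : coordChange e e' y ∈ e'.target := e'.map_source (by simp at hy; exact hy.2)
  have hsymm : IsSymmSndFDerivAt ℝ (coordChange e e') y :=
    (contDiffAt_coordChange he he' hy).isSymmSndFDerivAt (by simpa using ENat.LEInfty.out)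
  -- Both sides are tested against vectors `Dφ w`, with `φ` the coordinate change. By symmetry of
  -- `D²φ`, the second-order terms of the Koszul combination cancel except for two copies of
  -- `G'(D²φ(u, v), Dφ w)`, which the factor `1/2` reduces to one.
  refine g.inChart_injective he' hy2 fun w' ↦ ?_
  obtain ⟨w, rfl⟩ := (fderiv_coordChange_bijective he he' hy).2 w'
  rw [← g.inChart_coordChange he he' hy, g.inChart_christoffel he hy1, map_add,
    add_apply, g.inChart_christoffel he' hy2, christoffelFirst_apply,
    christoffelFirst_apply, g.fderiv_inChart_coordChange he he' hy,
    g.fderiv_inChart_coordChange he he' hy, g.fderiv_inChart_coordChange he he' hy,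
    hsymm v u, hsymm w u, hsymm w v,
    g.inChart_symm e' _ (fderiv ℝ (coordChange e e') y v) (fderiv ℝ (fderiv ℝ (coordChange e e')) y u w),
    g.inChart_symm e' _ (fderiv ℝ (coordChange e e') y u) (fderiv ℝ (fderiv ℝ (coordChange e e')) y v w)]
  ring

end PseudoRiemannianMetric

end MetricInCharts

/-! ### The complex structure in charts and complex linearity of the Christoffel symbols -/

noncomputable section ComplexCharts

set_option maxSynthPendingDepth 3

/-- Cauchy–Riemann: a real differential commuting with `i` is complex linear. Its continuity carries
over because restriction of scalars is an isometric embedding of spaces of linear maps. -/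
lemma contDiffOn_complex_of_fderiv_real {F F' : Type*} [NormedAddCommGroup F] [NormedSpace ℂ F]
    [NormedAddCommGroup F'] [NormedSpace ℂ F'] {f : F → F'} {s : Set F} (hs : IsOpen s)
    (hf : ContDiffOn ℝ 1 f s)
    (hI : ∀ z ∈ s, ∀ h, fderiv ℝ f z (Complex.I • h) = Complex.I • fderiv ℝ f z h) :
    ContDiffOn ℂ 1 f s := by
  have key : ∀ z ∈ s, ∃ L : F →L[ℂ] F', L.restrictScalars ℝ = fderiv ℝ f z ∧ HasFDerivAt f L z := by
    intro z hz
    let L : F →L[ℂ] F' :=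
      { toFun := fderiv ℝ f z
        map_add' := map_add _
        map_smul' := fun c h ↦ by
          have hc (x : F) : c • x = c.re • x + c.im • (Complex.I • x) := by
            conv_lhs => rw [← Complex.re_add_im c, add_smul, mul_smul]
            simp
          have hc' (x : F') : c • x = c.re • x + c.im • (Complex.I • x) := by
            conv_lhs => rw [← Complex.re_add_im c, add_smul, mul_smul]
            simp
          rw [RingHom.id_apply, hc, map_add, map_smul, map_smul, hI z hz, hc']
        cont := (fderiv ℝ f z).continuous }
    have hL : L.restrictScalars ℝ = fderiv ℝ f z := rfl
    exact ⟨L, hL, hasFDerivAt_of_restrictScalars ℝ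
      ((hf.contDiffAt (hs.mem_nhds hz)).differentiableAt one_ne_zero).hasFDerivAt hL⟩
  have hfd : EqOn (fun z ↦ (fderiv ℂ f z).restrictScalars ℝ) (fderiv ℝ f) s := by
    intro z hz
    obtain ⟨L, hL, hfL⟩ := key z hz
    simp only [hfL.fderiv, hL]
  rw [show (1 : WithTop ℕ∞) = 0 + 1 by simp, contDiffOn_succ_iff_fderiv_of_isOpen hs]
  refine ⟨fun z hz ↦ ?_, by simp, contDiffOn_zero.2 ?_⟩
  · obtain ⟨L, -, hfL⟩ := key z hz
    exact hfL.differentiableAt.differentiableWithinAt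
  · have := (hf.continuousOn_fderiv_of_isOpen hs le_rfl).congr hfd
    exact ((ContinuousLinearMap.restrictScalarsIsometry ℂ F F' ℝ ℝ).isometry.isEmbedding
      |>.isInducing.continuousOn_iff).2 this

variable {E : Type*} [NormedAddCommGroup E] [NormedSpace ℂ E]
  {M : Type*} [TopologicalSpace M] [ChartedSpace E M] [IsManifold 𝓘(ℂ, E) ω M]
  {e e' : OpenPartialHomeomorph M E}

lemma contDiffOn_complex_coordChange (he : e ∈ atlas E M) (he' : e' ∈ atlas E M) :
    ContDiffOn ℂ ω (coordChange e e') (e.symm ≫ₕ e').source := by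
  rw [← contMDiffOn_iff_contDiffOn]
  have h1 : ContMDiffOn 𝓘(ℂ, E) 𝓘(ℂ, E) ω e.symm e.target :=
    contMDiffOn_symm_of_mem_maximalAtlas (IsManifold.subset_maximalAtlas he)
  have h2 : ContMDiffOn 𝓘(ℂ, E) 𝓘(ℂ, E) ω e' e'.source :=
    contMDiffOn_of_mem_maximalAtlas (IsManifold.subset_maximalAtlas he')
  refine h2.comp (h1.mono ?_) ?_
  · intro y hy; simp at hy; exact hy.1
  · intro y hy; simp at hy; exact hy.2

lemma contDiffAt_complex_coordChange (he : e ∈ atlas E M) (he' : e' ∈ atlas E M) {y : E}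
    (hy : y ∈ (e.symm ≫ₕ e').source) : ContDiffAt ℂ ω (coordChange e e') y :=
  (contDiffOn_complex_coordChange he he').contDiffAt ((e.symm ≫ₕ e').open_source.mem_nhds hy)

lemma fderiv_real_coordChange (he : e ∈ atlas E M) (he' : e' ∈ atlas E M) {y : E}
    (hy : y ∈ (e.symm ≫ₕ e').source) : fderiv ℝ (coordChange e e') y =
      (fderiv ℂ (coordChange e e') y).restrictScalars ℝ :=
  (((contDiffAt_complex_coordChange he he' hy).differentiableAt (by simp)).hasFDerivAt
    |>.restrictScalars ℝ).fderiv

lemma fderiv_coordChange_I_smul (he : e ∈ atlas E M) (he' : e' ∈ atlas E M) {y : E}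
    (hy : y ∈ (e.symm ≫ₕ e').source) (v : E) : fderiv ℝ (coordChange e e') y (Complex.I • v) =
      Complex.I • fderiv ℝ (coordChange e e') y v := by
  rw [fderiv_real_coordChange he he' hy]
  simp

lemma fderiv_fderiv_coordChange_I_smul (he : e ∈ atlas E M) (he' : e' ∈ atlas E M) {y : E}
    (hy : y ∈ (e.symm ≫ₕ e').source) (u v : E) :
    fderiv ℝ (fderiv ℝ (coordChange e e')) y u (Complex.I • v) =
      Complex.I • fderiv ℝ (fderiv ℝ (coordChange e e')) y u v := by
  have h2 : HasFDerivAt (fderiv ℝ (coordChange e e')) (fderiv ℝ (fderiv ℝ (coordChange e e')) y) y :=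
    (((contDiffAt_coordChange he he' hy).fderiv_right (m := 1)
      (by norm_num; exact ENat.LEInfty.out)).differentiableAt one_ne_zero).hasFDerivAt
  have hl := h2.clm_apply (hasFDerivAt_const (Complex.I • v) y)
  have hr := (h2.clm_apply (hasFDerivAt_const v y)).const_smul Complex.I
  have := hl.unique (hr.congr_of_eventuallyEq (by
    filter_upwards [(e.symm ≫ₕ e').open_source.mem_nhds hy] with x hx
    exact fderiv_coordChange_I_smul he he' hx v))
  simpa using DFunLike.congr_fun this u

/-- Since tangent vectors are read in the preferred chart, `d(e⁻¹)` is the differential of a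
coordinate change, which is complex linear; so `J` is multiplication by `i` in every chart of the
atlas. -/
lemma mfderiv_chart_symm_eq (he : e ∈ atlas E M) {y : E} (hy : y ∈ e.target) (v : E) :
    mfderiv 𝓘(ℝ, E) 𝓘(ℝ, E) e.symm y v =
      fderiv ℝ (coordChange e (chartAt E (e.symm y))) y v := by
  rw [fderiv_coordChange he (chart_mem_atlas E _) (by simp [hy])]
  exact (mfderiv_chartAt_self (e.symm y) _).symm

lemma mfderiv_chart_symm_I_smul (he : e ∈ atlas E M) {y : E} (hy : y ∈ e.target) (v : E) :
    mfderiv 𝓘(ℝ, E) 𝓘(ℝ, E) e.symm y (Complex.I • v) =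
      complexStructure (e.symm y) (mfderiv 𝓘(ℝ, E) 𝓘(ℝ, E) e.symm y v) := by
  rw [mfderiv_chart_symm_eq he hy, mfderiv_chart_symm_eq he hy,
    fderiv_coordChange_I_smul he (chart_mem_atlas E _) (by simp [hy])]
  rfl

lemma mfderiv_chart_complexStructure (he : e ∈ atlas E M) {x : M} (hx : x ∈ e.source)
    (v : TangentSpace 𝓘(ℝ, E) x) :
    mfderiv 𝓘(ℝ, E) 𝓘(ℝ, E) e x (complexStructure x v) =
      Complex.I • (show E from mfderiv 𝓘(ℝ, E) 𝓘(ℝ, E) e x v) := by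
  have h1 := mfderiv_chart_symm_I_smul he (e.map_source hx) (mfderiv 𝓘(ℝ, E) 𝓘(ℝ, E) e x v)
  have h2 := mfderiv_mfderiv_symm he (e.map_source hx)
    (Complex.I • (show E from mfderiv 𝓘(ℝ, E) 𝓘(ℝ, E) e x v))
  rw [e.left_inv hx] at h2
  refine Eq.trans ?_ h2
  refine congrArg _ (Eq.trans ?_ h1.symm)
  exact congrArg (fun w : E ↦ Complex.I • w) (mfderiv_symm_mfderiv he hx v).symm

namespace PseudoRiemannianMetric

variable {g : PseudoRiemannianMetric E M}

/-- The covariant derivative of a field with constant coordinates is given by the Christoffel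
symbols. -/
lemma leviCivita_of_const (Y : Π x : M, TangentSpace 𝓘(ℝ, E) x) (x : M) (w : E)
    (hY : ∀ z ∈ (chartAt E x).target, mfderiv 𝓘(ℝ, E) 𝓘(ℝ, E) (chartAt E x)
      ((chartAt E x).symm z) (Y ((chartAt E x).symm z)) = w) (v : TangentSpace 𝓘(ℝ, E) x) :
    g.leviCivita Y x v = mfderiv 𝓘(ℝ, E) 𝓘(ℝ, E) (chartAt E x).symm (chartAt E x x)
      (g.christoffel (chartAt E x) (chartAt E x x) v w) := by
  have hx : chartAt E x x ∈ (chartAt E x).target := mem_chart_target E x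
  have h1 : (fun z : E ↦ (show E from mfderiv 𝓘(ℝ, E) 𝓘(ℝ, E) (chartAt E x)
      ((chartAt E x).symm z) (Y ((chartAt E x).symm z)))) =ᶠ[𝓝 (chartAt E x x)] fun _ ↦ w := by
    filter_upwards [(chartAt E x).open_target.mem_nhds hx] with z hz using hY z hz
  have h2 := h1.fderiv_eq (𝕜 := ℝ)
  rw [fderiv_const_apply] at h2
  have h3 : (show E from fderiv ℝ (fun z : E ↦ (show E from mfderiv 𝓘(ℝ, E) 𝓘(ℝ, E) (chartAt E x)
      ((chartAt E x).symm z) (Y ((chartAt E x).symm z)))) (chartAt E x x)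
        (mfderiv 𝓘(ℝ, E) 𝓘(ℝ, E) (chartAt E x) x v)) +
      g.christoffel (chartAt E x) (chartAt E x x) (mfderiv 𝓘(ℝ, E) 𝓘(ℝ, E) (chartAt E x) x v)
        (mfderiv 𝓘(ℝ, E) 𝓘(ℝ, E) (chartAt E x)
      ((chartAt E x).symm (chartAt E x x)) (Y ((chartAt E x).symm (chartAt E x x)))) =
      g.christoffel (chartAt E x) (chartAt E x x) v w := by
    rw [h2, hY _ hx, mfderiv_chartAt_self]
    exact zero_add _
  exact congrArg _ h3

/-- This is `∇J = 0` for the field with constant coordinates `w`. It is restricted to the base point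
of a preferred chart because `leviCivita` is computed there. -/
lemma IsAntiKaehler.christoffel_chartAt_I_smul (hg : g.IsAntiKaehler) (x : M) (v w : E) :
    g.christoffel (chartAt E x) (chartAt E x x) v (Complex.I • w) =
      Complex.I • g.christoffel (chartAt E x) (chartAt E x x) v w := by
  set e := chartAt E x
  have he : e ∈ atlas E M := chart_mem_atlas E x
  have hx : x ∈ e.source := mem_chart_source E x
  -- The values outside `e.source` are junk; only the germ at `x` matters.
  let X : Π y : M, TangentSpace 𝓘(ℝ, E) y :=
    fun y ↦ (show E from mfderiv 𝓘(ℝ, E) 𝓘(ℝ, E) e.symm (e y) w)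
  have hX : ∀ z ∈ e.target, mfderiv 𝓘(ℝ, E) 𝓘(ℝ, E) e (e.symm z) (X (e.symm z)) = w := by
    intro z hz
    have := mfderiv_mfderiv_symm he hz w
    refine Eq.trans (congrArg _ ?_) this
    change mfderiv 𝓘(ℝ, E) 𝓘(ℝ, E) e.symm (e (e.symm z)) w = _
    rw [e.right_inv hz]
  have hXd : MDifferentiableAt 𝓘(ℝ, E) (𝓘(ℝ, E).prod 𝓘(ℝ, E))
      (fun y ↦ (⟨y, X y⟩ : TangentBundle 𝓘(ℝ, E) M)) x := by
    have h1 := (contMDiffOn_mfderiv_chart_symm he w).comp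
      (contMDiffOn_of_mem_maximalAtlas (IsManifold.subset_maximalAtlas he)) e.mapsTo
    have h2 : ContMDiffAt 𝓘(ℝ, E) (𝓘(ℝ, E).prod 𝓘(ℝ, E)) ∞
      (fun y ↦ (⟨y, X y⟩ : TangentBundle 𝓘(ℝ, E) M)) x := by
      refine (h1.contMDiffAt (e.open_source.mem_nhds hx)).congr_of_eventuallyEq ?_
      filter_upwards [e.open_source.mem_nhds hx] with y hy
      have aux : ∀ (y' : M) (a : E), y' = y → (⟨y, a⟩ : TangentBundle 𝓘(ℝ, E) M) = ⟨y', a⟩ := by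
        rintro _ a rfl; rfl
      exact aux _ _ (e.left_inv hy)
    exact h2.mdifferentiableAt (by simp)
  have h := hg.parallel X x hXd v
  have hJX : ∀ z ∈ e.target, mfderiv 𝓘(ℝ, E) 𝓘(ℝ, E) e (e.symm z)
      (complexStructure (e.symm z) (X (e.symm z))) = Complex.I • w := fun z hz ↦
    (mfderiv_chart_complexStructure he (e.map_target hz) _).trans
      (congrArg (fun a : E ↦ Complex.I • a) (hX z hz))
  have h1 := leviCivita_of_const (g := g) X x w hX v
  have h2 := leviCivita_of_const (g := g) (fun y ↦ complexStructure y (X y)) x _ hJX v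
  have h3 := mfderiv_chart_symm_I_smul he (e.map_source hx) (g.christoffel e (e x) v w)
  have h4 : (show E from mfderiv 𝓘(ℝ, E) 𝓘(ℝ, E) e.symm (e x)
      (g.christoffel e (e x) v (Complex.I • w))) = mfderiv 𝓘(ℝ, E) 𝓘(ℝ, E) e.symm (e x)
      (Complex.I • g.christoffel e (e x) v w) :=
    h2.symm.trans (h.trans ((congrArg (fun a : E ↦ Complex.I • a) h1).trans h3.symm))
  exact (mfderiv_mfderiv_symm he (e.map_source hx) _).symm.trans
    ((congrArg (fun a : E ↦ (show E from mfderiv 𝓘(ℝ, E) 𝓘(ℝ, E) e (e.symm (e x)) a)) h4).trans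
      (mfderiv_mfderiv_symm he (e.map_source hx) _))

/-- Replace `v` by `iv` in the anti-Hermitian identity and use `i² = -1`. -/
lemma IsAntiKaehler.inChart_I_smul (hg : g.IsAntiKaehler) (he : e ∈ atlas E M) {y : E}
    (hy : y ∈ e.target) (u v : E) :
    g.inChart e y (Complex.I • u) v = g.inChart e y u (Complex.I • v) := by
  have h : ∀ u v : E, g.inChart e y (Complex.I • u) (Complex.I • v) = -g.inChart e y u v := by
    intro u v
    rw [inChart_apply, inChart_apply, mfderiv_chart_symm_I_smul he hy,
      mfderiv_chart_symm_I_smul he hy, hg.antiHermitian]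
  have h2 := h u (Complex.I • v)
  rw [smul_smul, Complex.I_mul_I, neg_one_smul, map_neg, neg_inj] at h2
  exact h2

variable [FiniteDimensional ℂ E]

/-- The transformation law transports the identity from the preferred chart at the point: the
inhomogeneous term `D²φ(u, v)` is also complex linear in `v`, as `φ` is holomorphic. -/
lemma IsAntiKaehler.christoffel_I_smul (hg : g.IsAntiKaehler) (he : e ∈ atlas E M) {y : E}
    (hy : y ∈ e.target) (u v : E) :
    g.christoffel e y u (Complex.I • v) = Complex.I • g.christoffel e y u v := by
  have he' : chartAt E (e.symm y) ∈ atlas E M := chart_mem_atlas E _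
  have hs : y ∈ (e.symm ≫ₕ chartAt E (e.symm y)).source := by simp [hy]
  apply (fderiv_coordChange_bijective he he' hs).1
  rw [g.fderiv_coordChange_christoffel he he' hs, fderiv_coordChange_I_smul he he' hs,
    fderiv_coordChange_I_smul he he' hs, fderiv_fderiv_coordChange_I_smul he he' hs,
    g.fderiv_coordChange_christoffel he he' hs, smul_add]
  exact congrArg (· + _) (hg.christoffel_chartAt_I_smul (e.symm y) _ _)

end PseudoRiemannianMetric

end ComplexCharts

/-! ### Holomorphy of the Christoffel symbols and of the geodesic field -/

noncomputable section HolomorphicChristoffel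

set_option maxSynthPendingDepth 3

namespace PseudoRiemannianMetric

section Real

variable {E : Type*} [NormedAddCommGroup E] [NormedSpace ℝ E] [FiniteDimensional ℝ E]
  {M : Type*} [TopologicalSpace M] [ChartedSpace E M] [IsManifold 𝓘(ℝ, E) ∞ M]
  (g : PseudoRiemannianMetric E M) {e e' : OpenPartialHomeomorph M E}

/-- The geodesic equation in the chart `e` as a vector field on the phase space `E × E`. -/
def geodesicField (e : OpenPartialHomeomorph M E) (z : E × E) : E × E :=
  (z.2, -g.christoffel e z.1 z.2 z.2)

lemma contDiffOn_geodesicField (he : e ∈ atlas E M) :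
    ContDiffOn ℝ ∞ (g.geodesicField e) (e.target ×ˢ univ) :=
  contDiffOn_snd.prodMk ((g.contDiffOn_christoffel he).comp
    (f := fun z : E × E ↦ (z.1, z.2, z.2)) (by fun_prop) fun z hz ↦ ⟨hz.1, trivial⟩).neg

lemma fderiv_inChart_symm (he : e ∈ atlas E M) {y : E} (hy : y ∈ e.target) (a u v : E) :
    fderiv ℝ (g.inChart e) y a u v = fderiv ℝ (g.inChart e) y a v u := by
  have h := g.hasFDerivAt_inChart he hy
  have hl := (h.clm_apply (hasFDerivAt_const u y)).clm_apply (hasFDerivAt_const v y)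
  have hr := (h.clm_apply (hasFDerivAt_const v y)).clm_apply (hasFDerivAt_const u y)
  have := hl.unique (hr.congr_of_eventuallyEq (.of_forall fun x ↦ g.inChart_symm e x u v))
  simpa using DFunLike.congr_fun this a

/-- The Levi-Civita connection is compatible with the metric. -/
lemma fderiv_inChart_eq_christoffel (he : e ∈ atlas E M) {y : E} (hy : y ∈ e.target) (a u v : E) :
    fderiv ℝ (g.inChart e) y a u v =
      g.inChart e y (g.christoffel e y a u) v + g.inChart e y u (g.christoffel e y a v) := by
  rw [g.inChart_symm e y u, g.inChart_christoffel he hy, g.inChart_christoffel he hy,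
    christoffelFirst_apply, christoffelFirst_apply, g.fderiv_inChart_symm he hy a v u]
  ring

lemma hasFDerivAt_fderiv_inChart (he : e ∈ atlas E M) {y : E} (hy : y ∈ e.target) :
    HasFDerivAt (fderiv ℝ (g.inChart e)) (fderiv ℝ (fderiv ℝ (g.inChart e)) y) y :=
  (((g.contDiffAt_inChart he hy).fderiv_right (m := 1)
    (by norm_num; exact ENat.LEInfty.out)).differentiableAt one_ne_zero).hasFDerivAt

lemma isSymmSndFDerivAt_inChart (he : e ∈ atlas E M) {y : E} (hy : y ∈ e.target) :
    IsSymmSndFDerivAt ℝ (g.inChart e) y :=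
  (g.contDiffAt_inChart he hy).isSymmSndFDerivAt (by simpa using ENat.LEInfty.out)

end Real

variable {E : Type*} [NormedAddCommGroup E] [NormedSpace ℂ E] [FiniteDimensional ℂ E]
  {M : Type*} [TopologicalSpace M] [ChartedSpace E M] [IsManifold 𝓘(ℂ, E) ω M]
  {g : PseudoRiemannianMetric E M} {e : OpenPartialHomeomorph M E}

lemma IsAntiKaehler.christoffel_I_smul_left (hg : g.IsAntiKaehler) (he : e ∈ atlas E M) {y : E}
    (hy : y ∈ e.target) (u v : E) :
    g.christoffel e y (Complex.I • u) v = Complex.I • g.christoffel e y u v := by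
  have h (u v : E) : g.christoffel e y u v = g.christoffel e y v u := by
    refine g.inChart_injective he hy fun w ↦ ?_
    rw [g.inChart_christoffel he hy, g.inChart_christoffel he hy, christoffelFirst_apply,
      christoffelFirst_apply, g.fderiv_inChart_symm he hy w u v]
    ring
  rw [h, hg.christoffel_I_smul he hy, h]

lemma IsAntiKaehler.fderiv_inChart_I_smul₁₂ (hg : g.IsAntiKaehler) (he : e ∈ atlas E M) {y : E}
    (hy : y ∈ e.target) (a u v : E) :
    fderiv ℝ (g.inChart e) y (Complex.I • a) u v =
      fderiv ℝ (g.inChart e) y a (Complex.I • u) v := by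
  simp only [g.fderiv_inChart_eq_christoffel he hy, hg.christoffel_I_smul_left he hy,
    hg.christoffel_I_smul he hy, hg.inChart_I_smul he hy]

lemma IsAntiKaehler.fderiv_inChart_I_smul₂₃ (hg : g.IsAntiKaehler) (he : e ∈ atlas E M) {y : E}
    (hy : y ∈ e.target) (a u v : E) :
    fderiv ℝ (g.inChart e) y a (Complex.I • u) v =
      fderiv ℝ (g.inChart e) y a u (Complex.I • v) := by
  simp only [g.fderiv_inChart_eq_christoffel he hy,
    hg.christoffel_I_smul he hy, hg.inChart_I_smul he hy]

lemma IsAntiKaehler.fderiv_fderiv_inChart_I_smul₂₃ (hg : g.IsAntiKaehler) (he : e ∈ atlas E M) {y : E}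
    (hy : y ∈ e.target) (b a u v : E) :
    fderiv ℝ (fderiv ℝ (g.inChart e)) y b (Complex.I • a) u v =
      fderiv ℝ (fderiv ℝ (g.inChart e)) y b a (Complex.I • u) v := by
  have h := g.hasFDerivAt_fderiv_inChart he hy
  have hl := ((h.clm_apply (hasFDerivAt_const (Complex.I • a) y)).clm_apply
    (hasFDerivAt_const u y)).clm_apply (hasFDerivAt_const v y)
  have hr := ((h.clm_apply (hasFDerivAt_const a y)).clm_apply
    (hasFDerivAt_const (Complex.I • u) y)).clm_apply (hasFDerivAt_const v y)
  have := hl.unique (hr.congr_of_eventuallyEq (by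
    filter_upwards [e.open_target.mem_nhds hy] with x hx
    exact hg.fderiv_inChart_I_smul₁₂ he hx a u v))
  simpa using DFunLike.congr_fun this b

lemma IsAntiKaehler.fderiv_fderiv_inChart_I_smul₃₄ (hg : g.IsAntiKaehler) (he : e ∈ atlas E M) {y : E}
    (hy : y ∈ e.target) (b a u v : E) :
    fderiv ℝ (fderiv ℝ (g.inChart e)) y b a (Complex.I • u) v =
      fderiv ℝ (fderiv ℝ (g.inChart e)) y b a u (Complex.I • v) := by
  have h := g.hasFDerivAt_fderiv_inChart he hy
  have hl := ((h.clm_apply (hasFDerivAt_const a y)).clm_apply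
    (hasFDerivAt_const (Complex.I • u) y)).clm_apply (hasFDerivAt_const v y)
  have hr := ((h.clm_apply (hasFDerivAt_const a y)).clm_apply
    (hasFDerivAt_const u y)).clm_apply (hasFDerivAt_const (Complex.I • v) y)
  have := hl.unique (hr.congr_of_eventuallyEq (by
    filter_upwards [e.open_target.mem_nhds hy] with x hx
    exact hg.fderiv_inChart_I_smul₂₃ he hx a u v))
  simpa using DFunLike.congr_fun this b

/-- Symmetry exchanges the two differentiation directions, so `i` can pass through the third slot
and come back to the second. -/
lemma IsAntiKaehler.fderiv_fderiv_inChart_I_smul₁₂ (hg : g.IsAntiKaehler) (he : e ∈ atlas E M) {y : E}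
    (hy : y ∈ e.target) (b a u v : E) :
    fderiv ℝ (fderiv ℝ (g.inChart e)) y (Complex.I • b) a u v =
      fderiv ℝ (fderiv ℝ (g.inChart e)) y b (Complex.I • a) u v := by
  have hs := g.isSymmSndFDerivAt_inChart he hy
  rw [hs (Complex.I • b) a, hg.fderiv_fderiv_inChart_I_smul₂₃ he hy, hs a b,
    ← hg.fderiv_fderiv_inChart_I_smul₂₃ he hy]

/-- The product rule applied to `G(Γ(u, v), w) = Γ(u, v; w)`; this avoids differentiating the
inverse of `G`. -/
lemma inChart_fderiv_christoffel (he : e ∈ atlas E M) {z : E × E × E} (hz : z.1 ∈ e.target)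
    (h : E × E × E) (w : E) :
    g.inChart e z.1
        (fderiv ℝ (fun z : E × E × E ↦ g.christoffel e z.1 z.2.1 z.2.2) z h) w =
      (1 / 2 : ℝ) *
        (fderiv ℝ (fderiv ℝ (g.inChart e)) z.1 h.1 z.2.1 z.2.2 w
          + fderiv ℝ (g.inChart e) z.1 h.2.1 z.2.2 w + fderiv ℝ (g.inChart e) z.1 z.2.1 h.2.2 w
          + (fderiv ℝ (fderiv ℝ (g.inChart e)) z.1 h.1 z.2.2 z.2.1 w
          + fderiv ℝ (g.inChart e) z.1 h.2.2 z.2.1 w + fderiv ℝ (g.inChart e) z.1 z.2.2 h.2.1 w)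
          - (fderiv ℝ (fderiv ℝ (g.inChart e)) z.1 h.1 w z.2.1 z.2.2
          + fderiv ℝ (g.inChart e) z.1 w h.2.1 z.2.2 + fderiv ℝ (g.inChart e) z.1 w z.2.1 h.2.2))
        - fderiv ℝ (g.inChart e) z.1 h.1 (g.christoffel e z.1 z.2.1 z.2.2) w := by
  have hopen : IsOpen (e.target ×ˢ (univ : Set (E × E))) := e.open_target.prod isOpen_univ
  have hnhds : e.target ×ˢ (univ : Set (E × E)) ∈ 𝓝 z := hopen.mem_nhds ⟨hz, trivial⟩
  have hK : HasFDerivAt (fun z : E × E × E ↦ g.christoffel e z.1 z.2.1 z.2.2)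
      (fderiv ℝ (fun z : E × E × E ↦ g.christoffel e z.1 z.2.1 z.2.2) z) z :=
    (((g.contDiffOn_christoffel he).contDiffAt hnhds).differentiableAt (by simp)).hasFDerivAt
  have hG := (g.hasFDerivAt_inChart he hz).comp z hasFDerivAt_fst
  have hD := (g.hasFDerivAt_fderiv_inChart he hz).comp z hasFDerivAt_fst
  have hu : HasFDerivAt (fun z : E × E × E ↦ z.2.1) _ z :=
    (ContinuousLinearMap.fst ℝ E E ∘L ContinuousLinearMap.snd ℝ E (E × E)).hasFDerivAt
  have hv : HasFDerivAt (fun z : E × E × E ↦ z.2.2) _ z :=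
    (ContinuousLinearMap.snd ℝ E E ∘L ContinuousLinearMap.snd ℝ E (E × E)).hasFDerivAt
  have hw := hasFDerivAt_const (𝕜 := ℝ) w z
  have hl := (hG.clm_apply hK).clm_apply hw
  have hr := (((((hD.clm_apply hu).clm_apply hv).clm_apply hw).add
    (((hD.clm_apply hv).clm_apply hu).clm_apply hw)).sub
    (((hD.clm_apply hw).clm_apply hu).clm_apply hv)).const_mul (1 / 2 : ℝ)
  have key := hl.unique (hr.congr_of_eventuallyEq (by
    filter_upwards [hnhds] with x hx
    exact g.inChart_christoffel he hx.1 x.2.1 x.2.2 w))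
  have := DFunLike.congr_fun key h
  simp at this
  rw [eq_sub_iff_add_eq, this]
  ring

/-- The Christoffel symbols of an anti-Kaehler metric are holomorphic. -/
lemma IsAntiKaehler.fderiv_christoffel_I_smul (hg : g.IsAntiKaehler) (he : e ∈ atlas E M)
    {z : E × E × E} (hz : z.1 ∈ e.target) (h : E × E × E) :
    fderiv ℝ (fun z : E × E × E ↦ g.christoffel e z.1 z.2.1 z.2.2) z (Complex.I • h) =
      Complex.I • fderiv ℝ (fun z : E × E × E ↦ g.christoffel e z.1 z.2.1 z.2.2) z h := by
  refine g.inChart_injective he hz fun w ↦ ?_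
  -- Each term is linear in the increment `h` and in `w`. One side carries `i` on `h`, the other on
  -- `w`; moving every `i` to the last slot makes them identical.
  rw [hg.inChart_I_smul he hz, inChart_fderiv_christoffel he hz, inChart_fderiv_christoffel he hz]
  simp only [Prod.smul_fst, Prod.smul_snd, hg.fderiv_inChart_I_smul₁₂ he hz,
    hg.fderiv_inChart_I_smul₂₃ he hz, hg.fderiv_fderiv_inChart_I_smul₁₂ he hz,
    hg.fderiv_fderiv_inChart_I_smul₂₃ he hz, hg.fderiv_fderiv_inChart_I_smul₃₄ he hz]

lemma IsAntiKaehler.contDiffOn_complex_geodesicField (hg : g.IsAntiKaehler) (he : e ∈ atlas E M) :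
    ContDiffOn ℂ 1 (g.geodesicField e) (e.target ×ˢ univ) := by
  have h : ContDiffOn ℂ 1 (fun z : E × E × E ↦ g.christoffel e z.1 z.2.1 z.2.2)
      (e.target ×ˢ univ) :=
    contDiffOn_complex_of_fderiv_real (e.open_target.prod isOpen_univ)
      ((g.contDiffOn_christoffel he).of_le ENat.LEInfty.out)
      fun z hz h ↦ hg.fderiv_christoffel_I_smul he hz.1 h
  exact contDiffOn_snd.prodMk (h.comp
    (f := fun z : E × E ↦ (z.1, z.2, z.2)) (by fun_prop) fun z hz ↦ ⟨hz.1, trivial⟩).neg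

end PseudoRiemannianMetric

end HolomorphicChristoffel

/-! ### Geodesics as a first-order system, and their uniqueness -/

noncomputable section Geodesics

set_option maxSynthPendingDepth 3

variable {E : Type*} [NormedAddCommGroup E] [NormedSpace ℝ E]
  {M : Type*} [TopologicalSpace M] {e e' : OpenPartialHomeomorph M E}
  {γ η : ℝ → M} {s : Set ℝ} {t : ℝ}

/-- Position and velocity of the curve `γ` in the chart `e`. -/
def chartState (e : OpenPartialHomeomorph M E) (γ : ℝ → M) (t : ℝ) : E × E :=
  (e (γ t), deriv (e ∘ γ) t)

/-- The change of position and velocity between two charts. -/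
def stateChange (e e' : OpenPartialHomeomorph M E) (z : E × E) : E × E :=
  (coordChange e e' z.1, fderiv ℝ (coordChange e e') z.1 z.2)

lemma chartState_congr (h : γ =ᶠ[𝓝 t] η) : chartState e γ t = chartState e η t := by
  simp only [chartState, h.eq_of_nhds, (h.fun_comp e).deriv_eq]

variable [ChartedSpace E M] [IsManifold 𝓘(ℝ, E) ∞ M]

lemma contDiffAt_chart_comp (he : e ∈ atlas E M) (hγ : ContMDiffAt 𝓘(ℝ, ℝ) 𝓘(ℝ, E) 2 γ t)
    (ht : γ t ∈ e.source) : ContDiffAt ℝ 2 (e ∘ γ) t := by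
  rw [← contMDiffAt_iff_contDiffAt]
  have h : ContMDiffAt 𝓘(ℝ, E) 𝓘(ℝ, E) ∞ e (γ t) :=
    (contMDiffOn_of_mem_maximalAtlas (IsManifold.subset_maximalAtlas he)).contMDiffAt
      (e.open_source.mem_nhds ht)
  exact (h.of_le ENat.LEInfty.out).comp t hγ

lemma chartState_eq_stateChange (he : e ∈ atlas E M) (he' : e' ∈ atlas E M)
    (hγ : ContMDiffAt 𝓘(ℝ, ℝ) 𝓘(ℝ, E) 2 γ t) (ht : γ t ∈ e.source) (ht' : γ t ∈ e'.source) :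
    chartState e' γ t = stateChange e e' (chartState e γ t) := by
  have hs : e (γ t) ∈ (e.symm ≫ₕ e').source := by simp [ht, ht']
  have h1 := ((contDiffAt_coordChange he he' hs).differentiableAt (by simp)).hasFDerivAt
  have h2 := ((contDiffAt_chart_comp he hγ ht).differentiableAt two_ne_zero).hasDerivAt
  have h3 := h1.comp_hasDerivAt t h2
  have h4 : e' ∘ γ =ᶠ[𝓝 t] coordChange e e' ∘ (e ∘ γ) := by
    filter_upwards [hγ.continuousAt.preimage_mem_nhds (e.open_source.mem_nhds ht)] with x hx
    simp [e.left_inv hx]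
  refine Prod.ext ?_ ?_
  · simp [chartState, stateChange, e.left_inv ht]
  · exact h4.deriv_eq.trans h3.deriv

lemma deriv_chartAt_comp {p : M} (hγ : ContMDiffAt 𝓘(ℝ, ℝ) 𝓘(ℝ, E) 2 γ t) (hp : γ t = p) :
    deriv (chartAt E p ∘ γ) t = (show E from mfderiv 𝓘(ℝ, ℝ) 𝓘(ℝ, E) γ t (1 : ℝ)) := by
  subst hp
  rw [← fderiv_apply_one_eq_deriv, ← mfderiv_eq_fderiv,
    mfderiv_comp t ((mdifferentiable_of_mem_atlas_real
      (chart_mem_atlas E (γ t))).mdifferentiableAt (mem_chart_source E (γ t)))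
      (hγ.mdifferentiableAt two_ne_zero)]
  exact mfderiv_chartAt_self (γ t) _

/-- The initial condition of a curve in terms of a chart. -/
lemma initial_iff {p : M} {v : TangentSpace 𝓘(ℝ, E) p}
    (hγ : ContMDiffAt 𝓘(ℝ, ℝ) 𝓘(ℝ, E) 2 γ t) :
    (⟨γ t, mfderiv 𝓘(ℝ, ℝ) 𝓘(ℝ, E) γ t (1 : ℝ)⟩ : TangentBundle 𝓘(ℝ, E) M) = ⟨p, v⟩ ↔
      γ t = p ∧ chartState (chartAt E p) γ t = (chartAt E p p, v) := by
  have aux : ∀ (q : M) (a : E), (⟨q, a⟩ : TangentBundle 𝓘(ℝ, E) M) = ⟨p, v⟩ ↔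
      q = p ∧ a = v := by
    intro q a
    constructor
    · intro h
      obtain rfl : q = p := congrArg TotalSpace.proj h
      exact ⟨rfl, TotalSpace.mk_injective _ h⟩
    · rintro ⟨rfl, h⟩
      rw [h]
  refine (aux _ _).trans (and_congr_right fun hp ↦ ?_)
  have h := deriv_chartAt_comp hγ hp
  exact ⟨fun h' ↦ Prod.ext (congrArg (chartAt E p) hp) (h.trans h'),
    fun h' ↦ h.symm.trans (congrArg Prod.snd h')⟩

namespace PseudoRiemannianMetric

variable {g : PseudoRiemannianMetric E M}

lemma IsGeodesicOn.contMDiffAt (h : g.IsGeodesicOn γ s) (hs : IsOpen s) (ht : t ∈ s) :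
    ContMDiffAt 𝓘(ℝ, ℝ) 𝓘(ℝ, E) 2 γ t :=
  h.contMDiffOn.contMDiffAt (hs.mem_nhds ht)

lemma IsGeodesicOn.mono (h : g.IsGeodesicOn γ s) {s' : Set ℝ} (hs : s' ⊆ s) :
    g.IsGeodesicOn γ s' :=
  ⟨h.contMDiffOn.mono hs, fun t ht ↦ h.equation t (hs ht)⟩

/-- Being a geodesic is a local property. -/
lemma isGeodesicOn_of_eventuallyEq
    (h : ∀ t ∈ s, ∃ (η : ℝ → M) (s' : Set ℝ), IsOpen s' ∧ t ∈ s' ∧ g.IsGeodesicOn η s' ∧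
      γ =ᶠ[𝓝 t] η) : g.IsGeodesicOn γ s := by
  refine ⟨fun t ht ↦ ?_, fun t ht e he hte ↦ ?_⟩
  · obtain ⟨η, s', hs', hts', hη, heq⟩ := h t ht
    exact ((hη.contMDiffAt hs' hts').congr_of_eventuallyEq heq).contMDiffWithinAt
  · obtain ⟨η, s', hs', hts', hη, heq⟩ := h t ht
    have h1 : e ∘ γ =ᶠ[𝓝 t] e ∘ η := heq.fun_comp e
    rw [h1.deriv.deriv_eq, h1.deriv_eq, heq.eq_of_nhds]
    exact hη.equation t hts' e he (heq.eq_of_nhds ▸ hte)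

lemma isGeodesicOn_const (p : M) (s : Set ℝ) : g.IsGeodesicOn (fun _ ↦ p) s := by
  refine ⟨contMDiffOn_const, fun t _ e _ _ ↦ ?_⟩
  have h1 : e ∘ (fun _ : ℝ ↦ p) = fun _ ↦ e p := rfl
  have h2 : g.christoffelFirst e (e p) 0 0 = 0 := by
    ext w; simp [christoffelFirst_apply]
  rw [h1]
  simp [christoffel, h2]

lemma IsGeodesicOn.hasDerivAt_chartState (h : g.IsGeodesicOn γ s) (hs : IsOpen s) (ht : t ∈ s)
    (he : e ∈ atlas E M) (hte : γ t ∈ e.source) :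
    HasDerivAt (chartState e γ) (g.geodesicField e (chartState e γ t)) t := by
  have h2 := contDiffAt_chart_comp he (h.contMDiffAt hs ht) hte
  have h3 : DifferentiableAt ℝ (deriv (e ∘ γ)) t :=
    ((h2.fderiv_right (m := 1) (by norm_num)).differentiableAt one_ne_zero).clm_apply
      (differentiableAt_const (1 : ℝ))
  have := (h2.differentiableAt two_ne_zero).hasDerivAt.prodMk h3.hasDerivAt
  rwa [eq_neg_of_add_eq_zero_left (h.equation t ht e he hte)] at this

variable [FiniteDimensional ℝ E]

/-- The solutions of the geodesic equation in a chart are geodesics. -/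
lemma isGeodesicOn_of_hasDerivAt (he : e ∈ atlas E M) (hs : IsOpen s) {z : ℝ → E × E}
    (hz : ∀ t ∈ s, z t ∈ e.target ×ˢ (univ : Set E) ∧ HasDerivAt z (g.geodesicField e (z t)) t) :
    g.IsGeodesicOn (fun t ↦ e.symm (z t).1) s ∧
      ∀ t ∈ s, chartState e (fun t ↦ e.symm (z t).1) t = z t := by
  have hz1 : ∀ t ∈ s, HasDerivAt (fun t ↦ (z t).1) (z t).2 t := fun t ht ↦ (hz t ht).2.fst
  have hz2 : ∀ t ∈ s, HasDerivAt (fun t ↦ (z t).2) (-g.christoffel e (z t).1 (z t).2 (z t).2) t :=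
    fun t ht ↦ (hz t ht).2.snd
  have hzc : ContinuousOn z s := fun t ht ↦ (hz t ht).2.continuousAt.continuousWithinAt
  -- Bootstrapping: the equation makes the derivative of the velocity continuous, so the velocity is
  -- `C¹` and the position `C²`.
  have hz2C : ContDiffOn ℝ 1 (fun t ↦ (z t).2) s := by
    rw [show (1 : WithTop ℕ∞) = 0 + 1 by simp, contDiffOn_succ_iff_deriv_of_isOpen hs]
    refine ⟨fun t ht ↦ (hz2 t ht).differentiableAt.differentiableWithinAt, by simp,
      contDiffOn_zero.2 ?_⟩
    have : ContinuousOn (fun t ↦ (g.geodesicField e (z t)).2) s :=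
      continuous_snd.comp_continuousOn
        ((g.contDiffOn_geodesicField he).continuousOn.comp hzc fun t ht ↦ (hz t ht).1)
    exact this.congr fun t ht ↦ (hz2 t ht).deriv
  have hz1C : ContDiffOn ℝ 2 (fun t ↦ (z t).1) s := by
    rw [show (2 : WithTop ℕ∞) = 1 + 1 by norm_num, contDiffOn_succ_iff_deriv_of_isOpen hs]
    exact ⟨fun t ht ↦ (hz1 t ht).differentiableAt.differentiableWithinAt, by simp,
      hz2C.congr fun t ht ↦ (hz1 t ht).deriv⟩
  refine ⟨⟨?_, fun t ht e' he' hte' ↦ ?_⟩, fun t ht ↦ ?_⟩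
  · have h1 : ContMDiffOn 𝓘(ℝ, E) 𝓘(ℝ, E) ∞ e.symm e.target :=
      contMDiffOn_symm_of_mem_maximalAtlas (IsManifold.subset_maximalAtlas he)
    exact (h1.of_le ENat.LEInfty.out).comp (contMDiffOn_iff_contDiffOn.2 hz1C)
      fun t ht ↦ (hz t ht).1.1
  · have hsrc : (z t).1 ∈ (e.symm ≫ₕ e').source := by
      simpa using ⟨(hz t ht).1.1, hte'⟩
    have hev : ∀ᶠ x in 𝓝 t, x ∈ s ∧ (z x).1 ∈ (e.symm ≫ₕ e').source :=
      (hs.eventually_mem ht).and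
        ((hz1 t ht).continuousAt.preimage_mem_nhds ((e.symm ≫ₕ e').open_source.mem_nhds hsrc))
    have hφ : ∀ y ∈ (e.symm ≫ₕ e').source,
        HasFDerivAt (coordChange e e') (fderiv ℝ (coordChange e e') y) y := fun y hy ↦
      ((contDiffAt_coordChange he he' hy).differentiableAt (by simp)).hasFDerivAt
    have hd : deriv (e' ∘ fun t ↦ e.symm (z t).1) =ᶠ[𝓝 t]
        fun x ↦ fderiv ℝ (coordChange e e') (z x).1 (z x).2 := by
      filter_upwards [hev] with x hx
      exact ((hφ _ hx.2).comp_hasDerivAt x (hz1 x hx.1)).deriv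
    have h2 : HasFDerivAt (fderiv ℝ (coordChange e e'))
        (fderiv ℝ (fderiv ℝ (coordChange e e')) (z t).1) (z t).1 :=
      (((contDiffAt_coordChange he he' hsrc).fderiv_right (m := 1)
        (by norm_num; exact ENat.LEInfty.out)).differentiableAt one_ne_zero).hasFDerivAt
    have h2' : HasDerivAt (fun x ↦ fderiv ℝ (coordChange e e') (z x).1)
        (fderiv ℝ (fderiv ℝ (coordChange e e')) (z t).1 (z t).2) t :=
      h2.comp_hasDerivAt t (hz1 t ht)
    have h3 := h2'.clm_apply (hz2 t ht)
    rw [hd.deriv_eq, hd.eq_of_nhds]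
    refine (congrArg (· + _) h3.deriv).trans ?_
    -- The second derivative of the coordinate change produced by differentiating twice cancels the
    -- inhomogeneous term of the transformation law.
    have htr := g.fderiv_coordChange_christoffel he he' hsrc (z t).2 (z t).2
    rw [map_neg, htr]
    simp only [Function.comp_apply]
    abel
  · have hev : (e ∘ fun t ↦ e.symm (z t).1) =ᶠ[𝓝 t] fun t ↦ (z t).1 := by
      filter_upwards [hs.mem_nhds ht] with x hx
      exact e.right_inv (hz x hx).1.1
    refine Prod.ext (hev.eq_of_nhds) ?_
    exact hev.deriv_eq.trans (hz1 t ht).deriv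

/-- Geodesics with the same position and velocity at a time agree near this time. -/
lemma IsGeodesicOn.eventuallyEq (hγ : g.IsGeodesicOn γ s) (hη : g.IsGeodesicOn η s)
    (hs : IsOpen s) (ht : t ∈ s) (he : e ∈ atlas E M) (hte : γ t ∈ e.source) (heq : γ t = η t)
    (hst : chartState e γ t = chartState e η t) : γ =ᶠ[𝓝 t] η := by
  have hC : ContDiffAt ℝ 1 (g.geodesicField e) (chartState e γ t) :=
    ((g.contDiffOn_geodesicField he).contDiffAt ((e.open_target.prod isOpen_univ).mem_nhds
      ⟨e.map_source hte, trivial⟩)).of_le ENat.LEInfty.out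
  -- A `C¹` field is locally Lipschitz, which gives ODE uniqueness.
  obtain ⟨K, N, hN, hK⟩ := hC.exists_lipschitzOnWith
  have aux : ∀ {ξ : ℝ → M}, g.IsGeodesicOn ξ s → ξ t ∈ e.source →
      N ∈ 𝓝 (chartState e ξ t) → ∀ᶠ x in 𝓝 t, ξ x ∈ e.source ∧
        HasDerivAt (chartState e ξ) (g.geodesicField e (chartState e ξ x)) x ∧
          chartState e ξ x ∈ N := by
    intro ξ hξ hξt hξN
    have h1 := (hξ.hasDerivAt_chartState hs ht he hξt).continuousAt.preimage_mem_nhds hξN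
    have h2 := (hξ.contMDiffAt hs ht).continuousAt.preimage_mem_nhds (e.open_source.mem_nhds hξt)
    filter_upwards [h1, h2, hs.mem_nhds ht] with x hx1 hx2 hx3
    exact ⟨hx2, hξ.hasDerivAt_chartState hs hx3 he hx2, hx1⟩
  have h1 := aux hγ hte hN
  have h2 := aux hη (heq ▸ hte) (hst ▸ hN)
  have := ODE_solution_unique_of_eventually (v := fun _ ↦ g.geodesicField e) (s := fun _ ↦ N)
    (.of_forall fun _ ↦ hK) (h1.mono fun _ h ↦ h.2) (h2.mono fun _ h ↦ h.2) hst
  filter_upwards [this, h1, h2] with x hx hx1 hx2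
  exact e.injOn hx1.1 hx2.1 (congrArg Prod.fst hx)

/-- Uniqueness of geodesics on a Hausdorff manifold. -/
theorem IsGeodesicOn.eqOn [T2Space M] (hγ : g.IsGeodesicOn γ s) (hη : g.IsGeodesicOn η s)
    (hs : IsOpen s) (hsc : IsPreconnected s) (ht : t ∈ s) (he : e ∈ atlas E M)
    (hte : γ t ∈ e.source) (heq : γ t = η t) (hst : chartState e γ t = chartState e η t) :
    EqOn γ η s := by
  suffices h : s ⊆ {x | γ =ᶠ[𝓝 x] η} from fun x hx ↦ (h hx).eq_of_nhds
  -- The set where the germs agree is open. It is closed in `s`: at a limit point the positions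
  -- agree since `M` is Hausdorff, then the velocities agree, and local uniqueness applies.
  refine hsc.subset_of_closure_inter_subset isOpen_setOfPred_eventually_nhds
    ⟨t, ht, hγ.eventuallyEq hη hs ht he hte heq hst⟩ ?_
  rintro x ⟨hxc, hxs⟩
  have hfr : ∃ᶠ y in 𝓝 x, γ =ᶠ[𝓝 y] η := mem_closure_iff_frequently.1 hxc
  have hx : γ x = η x := tendsto_nhds_unique_of_frequently_eq
    (hγ.contMDiffAt hs hxs).continuousAt (hη.contMDiffAt hs hxs).continuousAt
    (hfr.mono fun y hy ↦ hy.eq_of_nhds)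
  have hmem : γ x ∈ (chartAt E (γ x)).source := mem_chart_source E _
  have hat : chartAt E (γ x) ∈ atlas E M := chart_mem_atlas E _
  refine hγ.eventuallyEq hη hs hxs hat hmem hx (tendsto_nhds_unique_of_frequently_eq
    (hγ.hasDerivAt_chartState hs hxs hat hmem).continuousAt
    (hη.hasDerivAt_chartState hs hxs hat (hx ▸ hmem)).continuousAt
    (hfr.mono fun y hy ↦ chartState_congr hy))

end PseudoRiemannianMetric

end Geodesics

/-! ### Continuation of holomorphic families of geodesics up to time `1` -/

noncomputable section HolomorphicExponential

set_option maxSynthPendingDepth 3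

namespace PseudoRiemannianMetric

section Uniqueness

variable {E : Type*} [NormedAddCommGroup E] [NormedSpace ℝ E] [FiniteDimensional ℝ E]
  {M : Type*} [TopologicalSpace M] [T2Space M] [ChartedSpace E M] [IsManifold 𝓘(ℝ, E) ∞ M]
  {g : PseudoRiemannianMetric E M} {γ η : ℝ → M} {p : M} {v : TangentSpace 𝓘(ℝ, E) p}

/-- Geodesics with the same initial velocity agree. -/
lemma IsGeodesicOn.eqOn_of_initial {a b : ℝ} (ha : a < 0) (hb : 0 < b)
    (hγ : g.IsGeodesicOn γ (Ioo a b)) (hη : g.IsGeodesicOn η (Ioo a b))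
    (hγ0 : (⟨γ 0, mfderiv 𝓘(ℝ, ℝ) 𝓘(ℝ, E) γ 0 (1 : ℝ)⟩ : TangentBundle 𝓘(ℝ, E) M) = ⟨p, v⟩)
    (hη0 : (⟨η 0, mfderiv 𝓘(ℝ, ℝ) 𝓘(ℝ, E) η 0 (1 : ℝ)⟩ : TangentBundle 𝓘(ℝ, E) M) = ⟨p, v⟩) :
    EqOn γ η (Ioo a b) := by
  rw [initial_iff (hγ.contMDiffAt isOpen_Ioo ⟨ha, hb⟩)] at hγ0
  rw [initial_iff (hη.contMDiffAt isOpen_Ioo ⟨ha, hb⟩)] at hη0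
  exact hγ.eqOn hη isOpen_Ioo isPreconnected_Ioo ⟨ha, hb⟩ (chart_mem_atlas E p)
    (hγ0.1 ▸ mem_chart_source E _) (hγ0.1.trans hη0.1.symm) (hγ0.2.trans hη0.2.symm)

/-- Uniqueness on the common interval makes the end point independent of the choice hidden in `exp`.
-/
lemma exp_eq_of_expTo {q : M} (h : g.ExpTo p v q) : g.exp p v = q := by
  have hex : ∃ q, g.ExpTo p v q := ⟨q, h⟩
  have h' : g.ExpTo p v (g.exp p v) := by
    rw [exp, dif_pos hex]
    exact hex.choose_spec
  obtain ⟨γ, ε, hε, hγ, hγ0, rfl⟩ := h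
  obtain ⟨η, ε', hε', hη, hη0, hη1⟩ := h'
  have hm : 0 < min ε ε' := lt_min hε hε'
  have h1 : Ioo (-min ε ε') (1 + min ε ε') ⊆ Ioo (-ε) (1 + ε) :=
    Ioo_subset_Ioo (by simp) (by simp)
  have h2 : Ioo (-min ε ε') (1 + min ε ε') ⊆ Ioo (-ε') (1 + ε') :=
    Ioo_subset_Ioo (by simp) (by simp)
  rw [← hη1]
  exact ((hγ.mono h1).eqOn_of_initial (by linarith) (by linarith) (hη.mono h2) hγ0 hη0
    ⟨by linarith, by linarith⟩).symm

end Uniqueness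

variable {E : Type*} [NormedAddCommGroup E] [NormedSpace ℂ E]
  {M : Type*} [TopologicalSpace M] [ChartedSpace E M] [IsManifold 𝓘(ℂ, E) ω M]
  {e e' : OpenPartialHomeomorph M E}

lemma contDiffOn_complex_stateChange (he : e ∈ atlas E M) (he' : e' ∈ atlas E M) :
    ContDiffOn ℂ 1 (stateChange e e') ((e.symm ≫ₕ e').source ×ˢ univ) := by
  have hφ := contDiffOn_complex_coordChange he he'
  have hd : ContDiffOn ℂ 1 (fderiv ℂ (coordChange e e')) (e.symm ≫ₕ e').source :=
    hφ.fderiv_of_isOpen (e.symm ≫ₕ e').open_source le_top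
  have hfst : MapsTo (Prod.fst : E × E → E) ((e.symm ≫ₕ e').source ×ˢ univ)
    (e.symm ≫ₕ e').source := fun z hz ↦ hz.1
  have h : ContDiffOn ℂ 1 (fun z : E × E ↦ (coordChange e e' z.1,
      fderiv ℂ (coordChange e e') z.1 z.2)) ((e.symm ≫ₕ e').source ×ˢ univ) :=
    ((hφ.of_le le_top).comp contDiffOn_fst hfst).prodMk
      ((hd.comp contDiffOn_fst hfst).clm_apply contDiffOn_snd)
  refine h.congr fun z hz ↦ ?_
  rw [stateChange, fderiv_real_coordChange he he' hz.1]
  rfl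

/-- Near `v₀`, the geodesics starting at `p` are defined up to time `t`, and their positions and
velocities at this time depend holomorphically on the initial velocity. -/
def HolomorphicUpTo (g : PseudoRiemannianMetric E M) (p : M) (v₀ : E) (t : ℝ) : Prop :=
  ∃ U : Set E, IsOpen U ∧ v₀ ∈ U ∧ ∃ (γ : E → ℝ → M) (δ : ℝ), 0 < δ ∧
    (∀ v ∈ U, g.IsGeodesicOn (γ v) (Ioo (-δ) (t + δ)) ∧
      (⟨γ v 0, mfderiv 𝓘(ℝ, ℝ) 𝓘(ℝ, E) (γ v) 0 (1 : ℝ)⟩ : TangentBundle 𝓘(ℝ, E) M) = ⟨p, v⟩) ∧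
    ∃ e ∈ atlas E M, ∀ v ∈ U, γ v t ∈ e.source ∧
      DifferentiableAt ℂ (fun v ↦ chartState e (γ v) t) v

lemma zero_mem_expDomain (g : PseudoRiemannianMetric E M) (p : M) : 0 ∈ g.expDomain p := by
  refine ⟨p, fun _ ↦ p, 1, one_pos, isGeodesicOn_const p _, ?_, rfl⟩
  rw [mfderiv_const]
  rfl

variable {g : PseudoRiemannianMetric E M} [FiniteDimensional ℂ E]

/-- The geodesics in a chart as a local holomorphic flow. -/
lemma IsAntiKaehler.exists_localFlow (hg : g.IsAntiKaehler) (he : e ∈ atlas E M) {z₀ : E × E}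
    (hz₀ : z₀.1 ∈ e.target) :
    ∃ τ : ℝ, 0 < τ ∧ ∃ V : Set (E × E), IsOpen V ∧ z₀ ∈ V ∧ ∃ Φ : E × E → ℝ → E × E,
      (∀ z ∈ V, Φ z 0 = z ∧ ∀ t ∈ Ioo (-τ) τ, (Φ z t).1 ∈ e.target ∧
        DifferentiableAt ℂ (fun z ↦ Φ z t) z) ∧
      ∀ z ∈ V, ∀ t₀ : ℝ, g.IsGeodesicOn (fun t ↦ e.symm (Φ z (t - t₀)).1) (Ioo (t₀ - τ) (t₀ + τ)) ∧
        ∀ t ∈ Ioo (t₀ - τ) (t₀ + τ),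
          chartState e (fun t ↦ e.symm (Φ z (t - t₀)).1) t = Φ z (t - t₀) := by
  obtain ⟨τ, hτ, V, hV, hzV, Φ, hΦ⟩ := exists_holomorphic_localFlow
    (e.open_target.prod isOpen_univ) (hg.contDiffOn_complex_geodesicField he)
    (z₀ := z₀) ⟨hz₀, trivial⟩
  refine ⟨τ, hτ, V, hV, hzV, Φ, fun z hz ↦ ⟨(hΦ z hz).1, fun t ht ↦
    ⟨((hΦ z hz).2 t ht).1.1, ((hΦ z hz).2 t ht).2.2⟩⟩, fun z hz t₀ ↦ ?_⟩
  refine isGeodesicOn_of_hasDerivAt he isOpen_Ioo (z := fun t ↦ Φ z (t - t₀)) fun t ht ↦ ?_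
  obtain ⟨h1, h2, -⟩ := (hΦ z hz).2 (t - t₀) ⟨by linarith [ht.1], by linarith [ht.2]⟩
  refine ⟨h1, ?_⟩
  have := h2.scomp t ((hasDerivAt_id t).sub_const t₀)
  rwa [one_smul] at this

lemma IsAntiKaehler.holomorphicUpTo_zero (hg : g.IsAntiKaehler) (p : M) (v₀ : E) :
    g.HolomorphicUpTo p v₀ 0 := by
  have he : chartAt E p ∈ atlas E M := chart_mem_atlas E p
  obtain ⟨τ, hτ, V, hV, hzV, Φ, hΦ, hgeo⟩ := hg.exists_localFlow he
    (z₀ := (chartAt E p p, v₀)) (mem_chart_target E p)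
  have h0 : (0 : ℝ) ∈ Ioo (0 - τ) (0 + τ) := ⟨by linarith, by linarith⟩
  have hp : ∀ v, (chartAt E p p, v) ∈ V →
      (chartAt E p).symm (Φ (chartAt E p p, v) (0 - 0)).1 = p := by
    intro v hv
    rw [sub_zero, (hΦ _ hv).1, (chartAt E p).left_inv (mem_chart_source E p)]
  have hst : ∀ v, (chartAt E p p, v) ∈ V → chartState (chartAt E p)
      (fun t ↦ (chartAt E p).symm (Φ (chartAt E p p, v) (t - 0)).1) 0 = (chartAt E p p, v) := by
    intro v hv
    rw [(hgeo _ hv 0).2 0 h0, sub_zero, (hΦ _ hv).1]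
  have hU : IsOpen {v : E | (chartAt E p p, v) ∈ V} := hV.preimage (by fun_prop)
  refine ⟨{v : E | (chartAt E p p, v) ∈ V}, hU, hzV,
    fun v t ↦ (chartAt E p).symm (Φ (chartAt E p p, v) (t - 0)).1, τ, hτ, fun v hv ↦ ?_,
    chartAt E p, he, fun v hv ↦ ⟨?_, ?_⟩⟩
  · have hgeo' := (hgeo _ hv 0).1
    refine ⟨by simpa only [zero_sub] using hgeo', ?_⟩
    exact (initial_iff (hgeo'.contMDiffAt isOpen_Ioo h0)).2 ⟨hp v hv, hst v hv⟩
  · simp only [hp v hv]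
    exact mem_chart_source E p
  · refine (by fun_prop : DifferentiableAt ℂ (fun v : E ↦ (chartAt E p p, v)) v)
      |>.congr_of_eventuallyEq ?_
    filter_upwards [hU.mem_nhds hv] with w hw using hst w hw

/-- Continuation of the family of geodesics beyond the time `t`. -/
lemma IsAntiKaehler.holomorphicUpTo_step [T2Space M] (hg : g.IsAntiKaehler) {p : M} {v₀ : E}
    {γ₀ : ℝ → M} {ε b : ℝ} (hε : 0 < ε) (hγ₀ : g.IsGeodesicOn γ₀ (Ioo (-ε) b))
    (hγ₀0 : (⟨γ₀ 0, mfderiv 𝓘(ℝ, ℝ) 𝓘(ℝ, E) γ₀ 0 (1 : ℝ)⟩ : TangentBundle 𝓘(ℝ, E) M) = ⟨p, v₀⟩)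
    {t₀ : ℝ} (ht₀ : t₀ ∈ Ico 0 b) :
    ∃ κ : ℝ, 0 < κ ∧ ∀ t t', 0 ≤ t → t < t' → t < b → |t - t₀| < κ → |t' - t₀| < κ →
      g.HolomorphicUpTo p v₀ t → g.HolomorphicUpTo p v₀ t' := by
  have ht₀' : t₀ ∈ Ioo (-ε) b := ⟨by linarith [ht₀.1], ht₀.2⟩
  have hstar : chartAt E (γ₀ t₀) ∈ atlas E M := chart_mem_atlas E _
  have hsrc : γ₀ t₀ ∈ (chartAt E (γ₀ t₀)).source := mem_chart_source E _
  generalize chartAt E (γ₀ t₀) = e' at hstar hsrc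
  obtain ⟨τ, hτ, V, hV, hzV, Φ, hΦ, hgeo⟩ := hg.exists_localFlow hstar
    (z₀ := chartState e' γ₀ t₀) (e'.map_source hsrc)
  have hnear : ∀ᶠ t in 𝓝 t₀, γ₀ t ∈ e'.source ∧ chartState e' γ₀ t ∈ V :=
    ((hγ₀.contMDiffAt isOpen_Ioo ht₀').continuousAt.eventually_mem (e'.open_source.mem_nhds hsrc)).and
      ((hγ₀.hasDerivAt_chartState isOpen_Ioo ht₀' hstar hsrc).continuousAt.eventually_mem
        (hV.mem_nhds hzV))
  obtain ⟨κ, hκ, hκV⟩ := Metric.eventually_nhds_iff.1 hnear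
  -- Two times within `τ / 2` of `t₀` differ by less than `τ`, the lifetime of the local flow. The
  -- bound depends on `t₀` only, so steps may start before `t₀` and end after it.
  refine ⟨min κ (τ / 2), by positivity, fun t t' ht0 htt' htb ht ht' ⟨U, hU, hvU, γ, δ, hδ, hγ, e,
    he, hest⟩ ↦ ?_⟩
  obtain ⟨hte', htV⟩ := hκV (show dist t t₀ < κ from lt_of_lt_of_le ht (min_le_left _ _))
  have htτ : t' - t < τ := by
    have h1 := (abs_lt.1 (lt_of_lt_of_le ht (min_le_right _ _))).1
    have h2 := (abs_lt.1 (lt_of_lt_of_le ht' (min_le_right _ _))).2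
    linarith
  have hmemt : t ∈ Ioo (-δ) (t + δ) := ⟨by linarith, by linarith⟩
  have hγC : ∀ v ∈ U, ContMDiffAt 𝓘(ℝ, ℝ) 𝓘(ℝ, E) 2 (γ v) t := fun v hv ↦
    (hγ v hv).1.contMDiffAt isOpen_Ioo hmemt
  -- The central member of the family is the given geodesic, so its state at time `t` lies in the
  -- flow domain `V`; by continuity so do the states for `v` near `v₀`.
  have hγv₀ : γ v₀ =ᶠ[𝓝 t] γ₀ := by
    have h := ((hγ v₀ hvU).1.mono (s' := Ioo (-min δ ε) (min (t + δ) b))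
      (Ioo_subset_Ioo (by simp) (by simp))).eqOn_of_initial (by simp [hδ, hε])
      (lt_min (by linarith) (by linarith [ht₀.1, ht₀.2]))
      (hγ₀.mono (Ioo_subset_Ioo (by simp) (by simp))) (hγ v₀ hvU).2 hγ₀0
    exact h.eventuallyEq_of_mem (Ioo_mem_nhds (by linarith [lt_min hδ hε])
      (lt_min (by linarith) htb))
  let S : Set (E × E) := (e.symm ≫ₕ e').source ×ˢ univ
  have hS : IsOpen S := (e.symm ≫ₕ e').open_source.prod isOpen_univ
  have hC := contDiffOn_complex_stateChange he hstar
  let W : Set (E × E) := S ∩ stateChange e e' ⁻¹' V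
  have hW : IsOpen W := hC.continuousOn.isOpen_inter_preimage hS hV
  let U' : Set E := U ∩ (fun v ↦ chartState e (γ v) t) ⁻¹' W
  have hU' : IsOpen U' := ContinuousOn.isOpen_inter_preimage
    (fun v hv ↦ (hest v hv).2.continuousAt.continuousWithinAt) hU hW
  have hsrc' : ∀ v ∈ U', γ v t ∈ e'.source := by
    intro v hv
    have h1 : e (γ v t) ∈ (e.symm ≫ₕ e').source := hv.2.1.1
    simpa [e.left_inv (hest v hv.1).1, e.map_source (hest v hv.1).1] using h1
  have hchange : ∀ v ∈ U', chartState e' (γ v) t = stateChange e e' (chartState e (γ v) t) :=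
    fun v hv ↦ chartState_eq_stateChange he hstar (hγC v hv.1) (hest v hv.1).1 (hsrc' v hv)
  have hvU' : v₀ ∈ U' := by
    have h1 : γ v₀ t ∈ e.source := (hest v₀ hvU).1
    have h2 : γ v₀ t ∈ e'.source := hγv₀.eq_of_nhds ▸ hte'
    refine ⟨hvU, ⟨?_, trivial⟩, ?_⟩
    · change e (γ v₀ t) ∈ (e.symm ≫ₕ e').source
      simp [h1, h2]
    · change stateChange e e' (chartState e (γ v₀) t) ∈ V
      rw [← chartState_eq_stateChange he hstar (hγC v₀ hvU) h1 h2, chartState_congr hγv₀]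
      exact htV
  have hσV : ∀ v ∈ U', chartState e' (γ v) t ∈ V := fun v hv ↦ hchange v hv ▸ hv.2.2
  have hσd : ∀ v ∈ U', DifferentiableAt ℂ (fun v ↦ chartState e' (γ v) t) v := by
    intro v hv
    have h1 : DifferentiableAt ℂ (stateChange e e') (chartState e (γ v) t) :=
      (hC.contDiffAt (hS.mem_nhds hv.2.1)).differentiableAt one_ne_zero
    refine (h1.comp v (hest v hv.1).2).congr_of_eventuallyEq ?_
    filter_upwards [hU'.mem_nhds hv] with w hw using hchange w hw
  let β : E → ℝ → M := fun v x ↦ e'.symm (Φ (chartState e' (γ v) t) (x - t)).1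
  have hβ : ∀ v ∈ U', g.IsGeodesicOn (β v) (Ioo (t - τ) (t + τ)) := fun v hv ↦
    (hgeo _ (hσV v hv) t).1
  have hβs : ∀ v ∈ U', ∀ x ∈ Ioo (t - τ) (t + τ),
      chartState e' (β v) x = Φ (chartState e' (γ v) t) (x - t) := fun v hv ↦
    (hgeo _ (hσV v hv) t).2
  have hmemτ : t ∈ Ioo (t - τ) (t + τ) := ⟨by linarith, by linarith⟩
  have hγβ : ∀ v ∈ U', γ v =ᶠ[𝓝 t] β v := by
    intro v hv
    have h0 := (hΦ _ (hσV v hv)).1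
    refine ((hγ v hv.1).1.mono inter_subset_left).eventuallyEq ((hβ v hv).mono inter_subset_right)
      (isOpen_Ioo.inter isOpen_Ioo) ⟨hmemt, hmemτ⟩ hstar (hsrc' v hv) ?_ ?_
    · simp only [β, sub_self, h0]
      exact (e'.left_inv (hsrc' v hv)).symm
    · rw [hβs v hv t hmemτ, sub_self, h0]
  classical
  -- Gluing at `t` yields a geodesic because the two pieces agree on a whole neighbourhood of `t`,
  -- having the same state there.
  let γ' : E → ℝ → M := fun v x ↦ if x ≤ t then γ v x else β v x
  have hγ'γ : ∀ v ∈ U', ∀ x ≤ t, γ' v =ᶠ[𝓝 x] γ v := by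
    intro v hv x hx
    rcases hx.lt_or_eq with hx | rfl
    · filter_upwards [Iio_mem_nhds hx] with y hy
      exact if_pos (le_of_lt hy)
    · filter_upwards [hγβ v hv] with y hy
      by_cases h : y ≤ x
      · exact if_pos h
      · exact (if_neg h).trans hy.symm
  have hγ'β : ∀ v, ∀ x, t < x → γ' v =ᶠ[𝓝 x] β v := by
    intro v x hx
    filter_upwards [Ioi_mem_nhds hx] with y hy
    exact if_neg (not_le.2 hy)
  have htt'' : t' ∈ Ioo (t - τ) (t + τ) := ⟨by linarith, by linarith⟩
  refine ⟨U', hU', hvU', γ', min δ (t + τ - t'), lt_min hδ (by linarith), fun v hv ↦ ⟨?_, ?_⟩,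
    e', hstar, fun v hv ↦ ⟨?_, ?_⟩⟩
  · refine isGeodesicOn_of_eventuallyEq fun x hx ↦ ?_
    have hx1 : -δ < x := lt_of_le_of_lt (neg_le_neg (min_le_left _ _)) hx.1
    have hx2 : x < t + τ := by linarith [hx.2, min_le_right δ (t + τ - t')]
    rcases le_or_gt x t with hxt | hxt
    · exact ⟨γ v, _, isOpen_Ioo, ⟨hx1, by linarith⟩, (hγ v hv.1).1, hγ'γ v hv x hxt⟩
    · exact ⟨β v, _, isOpen_Ioo, ⟨by linarith, hx2⟩, hβ v hv, hγ'β v x hxt⟩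
  · have h1 := hγ'γ v hv 0 ht0
    have hm0 : (0 : ℝ) ∈ Ioo (-δ) (t + δ) := ⟨by linarith, by linarith⟩
    have h2 := (hγ v hv.1).1.contMDiffAt isOpen_Ioo hm0
    have h3 := (initial_iff h2).1 (hγ v hv.1).2
    exact (initial_iff (h2.congr_of_eventuallyEq h1)).2
      ⟨h1.eq_of_nhds.trans h3.1, (chartState_congr h1).trans h3.2⟩
  · rw [(hγ'β v t' htt').eq_of_nhds]
    exact e'.map_target ((hΦ _ (hσV v hv)).2 (t' - t) ⟨by linarith, by linarith⟩).1
  · have h1 := ((hΦ _ (hσV v hv)).2 (t' - t) ⟨by linarith, by linarith⟩).2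
    refine (h1.comp v (hσd v hv)).congr_of_eventuallyEq ?_
    filter_upwards [hU'.mem_nhds hv] with w hw
    rw [chartState_congr (hγ'β w t' htt'), hβs w hw t' htt'']
    rfl

/-- The geodesics starting at `p` depend holomorphically on the initial velocity. -/
theorem IsAntiKaehler.holomorphicUpTo [T2Space M] (hg : g.IsAntiKaehler) {p : M} {v₀ : E}
    {γ₀ : ℝ → M} {ε b : ℝ} (hε : 0 < ε) (hγ₀ : g.IsGeodesicOn γ₀ (Ioo (-ε) b))
    (hγ₀0 : (⟨γ₀ 0, mfderiv 𝓘(ℝ, ℝ) 𝓘(ℝ, E) γ₀ 0 (1 : ℝ)⟩ : TangentBundle 𝓘(ℝ, E) M) = ⟨p, v₀⟩)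
    {t : ℝ} (ht : t ∈ Ico 0 b) : g.HolomorphicUpTo p v₀ t := by
  let A : Set ℝ := {x | x ∈ Icc 0 t ∧ g.HolomorphicUpTo p v₀ x}
  have h0A : (0 : ℝ) ∈ A := ⟨⟨le_rfl, ht.1⟩, hg.holomorphicUpTo_zero p v₀⟩
  have hbdd : BddAbove A := ⟨t, fun x hx ↦ hx.1.2⟩
  have hs0 : 0 ≤ sSup A := le_csSup hbdd h0A
  have hst : sSup A ≤ t := csSup_le ⟨0, h0A⟩ fun x hx ↦ hx.1.2
  obtain ⟨κ, hκ, hstep⟩ := hg.holomorphicUpTo_step hε hγ₀ hγ₀0 (t₀ := sSup A)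
    ⟨hs0, hst.trans_lt ht.2⟩
  obtain ⟨x, hxA, hx⟩ := exists_lt_of_lt_csSup ⟨0, h0A⟩ (sub_lt_self (sSup A) hκ)
  have hxs : x ≤ sSup A := le_csSup hbdd hxA
  -- A single step from a time `x` of `A` close to `sSup A` reaches every later time below `sSup A +
  -- κ`. Hence `sSup A < t` would contradict the supremum.
  have key : ∀ t', x ≤ t' → t' < sSup A + κ → g.HolomorphicUpTo p v₀ t' := by
    intro t' hxt' ht'
    rcases hxt'.eq_or_lt with rfl | hlt
    · exact hxA.2
    · exact hstep x t' hxA.1.1 hlt (by linarith [ht.2]) (abs_lt.2 ⟨by linarith, by linarith⟩)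
        (abs_lt.2 ⟨by linarith, by linarith⟩) hxA.2
  rcases hst.eq_or_lt with h | h
  · exact h ▸ key (sSup A) hxs (by linarith)
  · have hm : min t (sSup A + κ / 2) ∈ A :=
      ⟨⟨le_min ht.1 (by linarith), min_le_left _ _⟩,
        key _ (le_min (by linarith) (by linarith)) ((min_le_right _ _).trans_lt (by linarith))⟩
    have := le_csSup hbdd hm
    exact absurd this (not_le.2 (lt_min h (by linarith)))

/-- Near `v₀`, `exp` is the inverse chart, which is holomorphic, composed with the position at time
`1` of the holomorphic family. -/
lemma IsAntiKaehler.exists_expDomain_nhds [T2Space M] (hg : g.IsAntiKaehler) {p : M} {v₀ : E}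
    (hv₀ : v₀ ∈ (g.expDomain p : Set E)) :
    (g.expDomain p : Set E) ∈ 𝓝 v₀ ∧
      MDifferentiableAt 𝓘(ℂ, E) 𝓘(ℂ, E) (fun v : E ↦ g.exp p v) v₀ := by
  obtain ⟨q, γ₀, ε, hε, hγ₀, hγ₀0, -⟩ := hv₀
  obtain ⟨U, hU, hvU, γ, δ, hδ, hγ, e, he, hest⟩ :=
    hg.holomorphicUpTo hε hγ₀ hγ₀0 (t := 1) ⟨zero_le_one, by linarith⟩
  have hexp : ∀ v ∈ U, g.ExpTo p v (γ v 1) := fun v hv ↦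
    ⟨γ v, δ, hδ, (hγ v hv).1, (hγ v hv).2, rfl⟩
  refine ⟨Filter.mem_of_superset (hU.mem_nhds hvU) fun v hv ↦ ⟨_, hexp v hv⟩, ?_⟩
  have h1 : DifferentiableAt ℂ (fun v ↦ e (γ v 1)) v₀ := (hest v₀ hvU).2.fst
  have h2 : MDifferentiableAt 𝓘(ℂ, E) 𝓘(ℂ, E) e.symm (e (γ v₀ 1)) :=
    ((contMDiffOn_symm_of_mem_maximalAtlas (I := 𝓘(ℂ, E)) (n := ω)
      (IsManifold.subset_maximalAtlas he)).contMDiffAt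
        (e.open_target.mem_nhds (e.map_source (hest v₀ hvU).1))).mdifferentiableAt (by simp)
  refine (h2.comp v₀ h1.mdifferentiableAt).congr_of_eventuallyEq ?_
  filter_upwards [hU.mem_nhds hvU] with v hv
  rw [exp_eq_of_expTo (hexp v hv)]
  exact (e.left_inv (hest v hv).1).symm

end PseudoRiemannianMetric

end HolomorphicExponential

theorem proposition3p1 {E : Type*} [NormedAddCommGroup E] [NormedSpace ℂ E] [FiniteDimensional ℂ E]
    {M : Type*} [TopologicalSpace M] [T2Space M] [ChartedSpace E M] [IsManifold 𝓘(ℂ, E) ω M]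
    (g : PseudoRiemannianMetric E M) (hg : g.IsAntiKaehler) (p : M) :
    IsOpen (g.expDomain p) ∧ 0 ∈ g.expDomain p ∧
      MDifferentiableOn 𝓘(ℂ, E) 𝓘(ℂ, E) (fun v : E ↦ g.exp p v) (g.expDomain p : Set E) :=
  ⟨isOpen_iff_mem_nhds.2 fun _ hv ↦ (hg.exists_expDomain_nhds hv).1, g.zero_mem_expDomain p,
    fun _ hv ↦ (hg.exists_expDomain_nhds hv).2.mdifferentiableWithinAt⟩
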